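/- Let $\mathbb K$ be $\mathbb R$ or $\mathbb C$, let $\Omega\subseteq\mathbb R^2$ be open, and let all functions below be $\mathbb K$-valued functions of $(x,t)\in\Omega$, regular enough for the derivatives that occur to exist and to commute. For functions $g_1,\dots,g_m$ let $W(g_1,\dots,g_m)=\det(\partial_x^{i-1}g_j)_{i,j=1}^m$ be their Wronskian in $x$, and write $\partial_x^2\ln w$ for $\partial_x(w_x/w)$. For $N\ge 0$ and $\lambda_1,\dots,\lambda_N\in\mathbb K$, the KdV equation with $N$ self-consistent sources (KdVES) is $$u_t=-(6uu_x+u_{xxx})-2\,\partial_x\sum_{j=1}^N\phi_j^2,\qquad \phi_{j,xx}+(\lambda_j+u)\phi_j=0\quad(j=1,\dots,N),\tag{1}$$ and its Lax pair with spectral parameter $\lambda\notin\{\lambda_1,\dots,\lambda_N\}$ is the linear problem $$\psi_{xx}+(\lambda+u)\psi=0,\qquad \psi_t=u_x\psi+(4\lambda-2u)\psi_x+\sum_{j=1}^N\frac{1}{\lambda-\lambda_j}\,\phi_j(\phi_{j,x}\psi-\phi_j\psi_x).\tag{2}$$ Proposition. Suppose that $u,\phi_1,\dots,\phi_N$ is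 a solution of (1), that $\lambda_{N+1}\in\mathbb K$ differs from $\lambda_1,\dots,\lambda_N$, that $f$ solves (2) with $\lambda=\lambda_{N+1}$, that $g(x,t,\lambda)$ solves (2) for all $\lambda$ near $\lambda_{N+1}$ and is differentiable in $\lambda$ at $\lambda_{N+1}$, this differentiation commuting with $\partial_x,\partial_x^2,\partial_t,\partial_t\partial_x$, and that $W(f,g)\ne0$ on $\Omega$ at $\lambda=\lambda_{N+1}$. Let $C(t)$ be a differentiable function of $t$, let $\sqrt{C_t/W(f,g)}$ be a function of $t$ whose square is $C_t/W(f,g)$ on $\Omega$, and put $g=g(x,t,\lambda_{N+1})$, $$T=C(t)f+\partial_\lambda g(x,t,\lambda)\big|_{\lambda=\lambda_{N+1}},\qquad \widetilde u=u+2\,\partial_x^2\ln W(g,T),$$ $$\widetilde\phi_j=\frac{1}{\lambda_j-\lambda_{N+1}}\,\frac{W(g,T,\phi_j)}{W(g,T)}\quad(1\le j\le N),\qquad \widetilde\phi_{N+1}=\sqrt{\frac{C_t}{W(f,g)}}\;\frac{W(g,T,f)}{W(g,T)}.$$ Then, on the set of points of $\Omega$ where $W(g,T)\neq0$: (a) $\widetilde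 u,\widetilde\phi_1,\dots,\widetilde\phi_{N+1}$ is a solution of (1) with $N+1$ sources and parameters $\lambda_1,\dots,\lambda_{N+1}$; (b) for every $\lambda\notin\{\lambda_1,\dots,\lambda_{N+1}\}$ and every solution $\psi$ of (2), the function $\widetilde\psi=W(g,T,\psi)/W(g,T)$ together with $\widetilde u,\widetilde\phi_1,\dots,\widetilde\phi_{N+1}$ satisfies (2) with $N+1$ sources. Moreover this transformation yields the positon and negaton solutions. Let $k>0$, let $\eta,C:\mathbb R\to\mathbb R$ be differentiable with $\eta_t\ge0$ and $C_t\ge0$, let $b:\mathbb R\to\mathbb R$ be differentiable at $k$, and start from the solution $u=0$, $\phi_1=\sqrt{\eta_t}$ of (1) on $\mathbb R^2$ with $N=1$, $\lambda_1=0$. (c) (Positon) For $\Theta=kx+4k^3t-\eta(t)/k+b(k)$, $f=\cos\Theta$, $g=\sin\Theta$, $\lambda=k^2$, the hypotheses above hold, and with $\gamma=C(t)+\frac1{2k}\partial_k\Theta$ the transformed functions, which are defined exactly where $4k^2\gamma\ne\sin2\Theta$, are $$\widetilde u=\frac{32k^2(2k^2\gamma\cos\Theta-\sin\Theta)\sin\Theta}{(4k^2\gamma-\sin2\Theta)^2},\quad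 \widetilde\phi_1=\frac{-\sqrt{\eta_t}\,(4k^2\gamma+\sin2\Theta)}{4k^2\gamma-\sin2\Theta},\quad \widetilde\phi_2=\frac{4k\sqrt{kC_t}\,\sin\Theta}{4k^2\gamma-\sin2\Theta},$$ and they solve (1) with $N=2$ and parameters $0,k^2$. (d) (Negaton) For $\Theta=kx-4k^3t+\eta(t)/k+b(k)$, $f=\cosh\Theta$, $g=\sinh\Theta$, $\lambda=-k^2$, the hypotheses above hold, and with $\gamma=C(t)-\frac1{2k}\partial_k\Theta$ the transformed functions, which are defined exactly where $2k^2\gamma+\sinh\Theta\cosh\Theta\ne0$, are $$\widetilde u=\frac{8k^2(2k^2\gamma\cosh\Theta+\sinh\Theta)\sinh\Theta}{(2k^2\gamma+\sinh\Theta\cosh\Theta)^2},\quad \widetilde\phi_1=\frac{\sqrt{\eta_t}\,(-2k^2\gamma+\sinh\Theta\cosh\Theta)}{2k^2\gamma+\sinh\Theta\cosh\Theta},\quad \widetilde\phi_2=\frac{2k\sqrt{kC_t}\,\sinh\Theta}{2k^2\gamma+\sinh\Theta\cosh\Theta},$$ and they solve (1) with $N=2$ and parameters $0,-k^2$. -/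

import Mathlib

open scoped Topology

noncomputable section

namespace KdVES

variable {𝕜 : Type*} [RCLike 𝕜]

/-- The partial derivative in the space variable. -/
def dx (F : ℝ → ℝ → 𝕜) : ℝ → ℝ → 𝕜 := fun x t => deriv (fun y => F y t) x

/-- The partial derivative in time. -/
def dt (F : ℝ → ℝ → 𝕜) : ℝ → ℝ → 𝕜 := fun x t => deriv (fun s => F x s) t

/-- The derivative of a family of functions in the spectral parameter. -/
def dlam (g : 𝕜 → ℝ → ℝ → 𝕜) (μ₀ : 𝕜) : ℝ → ℝ → 𝕜 :=
  fun x t => deriv (fun μ => g μ x t) μ₀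

/-- The Wronskian determinant, in the space variable, of `m` functions. -/
def wronskian {m : ℕ} (F : Fin m → ℝ → ℝ → 𝕜) : ℝ → ℝ → 𝕜 := fun x t =>
  Matrix.det (Matrix.of fun i j : Fin m => iteratedDeriv (i : ℕ) (fun y => F j y t) x)

/-- The second `x`-derivative of `ln F`, that is, the `x`-derivative of `F_x / F`
(independent of the branch of the logarithm). -/
def dxxLog (F : ℝ → ℝ → 𝕜) : ℝ → ℝ → 𝕜 := dx fun x t => logDeriv (fun y => F y t) x

/-- `F` is `k` times differentiable in `x` at the points of `Ω`. -/
def XDiff (k : ℕ) (Ω : Set (ℝ × ℝ)) (F : ℝ → ℝ → 𝕜) : Prop :=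
  ∀ p ∈ Ω, ∀ i < k, DifferentiableAt ℝ (iteratedDeriv i fun y => F y p.2) p.1

/-- `F` is differentiable in `t` at the points of `Ω`. -/
def TDiff (Ω : Set (ℝ × ℝ)) (F : ℝ → ℝ → 𝕜) : Prop :=
  ∀ p ∈ Ω, DifferentiableAt ℝ (fun s => F p.1 s) p.2

/-- `u, φ₁, …, φₙ` is a solution on `Ω` of the KdV equation with `n` self-consistent sources
and eigenvalues `lam`. -/
structure IsKdVES {n : ℕ} (Ω : Set (ℝ × ℝ)) (lam : Fin n → 𝕜) (u : ℝ → ℝ → 𝕜)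
    (φ : Fin n → ℝ → ℝ → 𝕜) : Prop where
  u_xdiff : XDiff 3 Ω u
  u_tdiff : TDiff Ω u
  φ_xdiff : ∀ j, XDiff 2 Ω (φ j)
  evolution : ∀ p ∈ Ω, dt u p.1 p.2 =
    -(6 * u p.1 p.2 * dx u p.1 p.2 + dx (dx (dx u)) p.1 p.2)
      - 2 * dx (fun x t => ∑ j, φ j x t ^ 2) p.1 p.2
  schrodinger : ∀ j, ∀ p ∈ Ω,
    dx (dx (φ j)) p.1 p.2 + (lam j + u p.1 p.2) * φ j p.1 p.2 = 0

/-- `ψ` is a solution on `Ω`, with spectral parameter `μ`, of the auxiliary linear problem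
(Lax pair) of the KdV equation with `n` sources; `ψ_xt` and `ψ_tx` exist and agree. -/
structure IsLax {n : ℕ} (Ω : Set (ℝ × ℝ)) (lam : Fin n → 𝕜) (u : ℝ → ℝ → 𝕜)
    (φ : Fin n → ℝ → ℝ → 𝕜) (μ : 𝕜) (ψ : ℝ → ℝ → 𝕜) : Prop where
  xdiff : XDiff 2 Ω ψ
  tdiff : TDiff Ω ψ
  tdiff_dx : TDiff Ω (dx ψ)
  xdiff_dt : XDiff 1 Ω (dt ψ)
  mixed : ∀ p ∈ Ω, dt (dx ψ) p.1 p.2 = dx (dt ψ) p.1 p.2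
  schrodinger : ∀ p ∈ Ω, dx (dx ψ) p.1 p.2 + (μ + u p.1 p.2) * ψ p.1 p.2 = 0
  evolution : ∀ p ∈ Ω, dt ψ p.1 p.2 =
    dx u p.1 p.2 * ψ p.1 p.2 + (4 * μ - 2 * u p.1 p.2) * dx ψ p.1 p.2
      + ∑ j, 1 / (μ - lam j) *
        (φ j p.1 p.2 * (dx (φ j) p.1 p.2 * ψ p.1 p.2 - φ j p.1 p.2 * dx ψ p.1 p.2))

/-- Regularity in the spectral parameter: on `Ω`, the family `g` is differentiable in the
parameter at `μ₀`, and this differentiation commutes with `∂ₓ`, `∂ₓ²`, `∂ₜ` and `∂ₜ∂ₓ`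
(all of this holds for a jointly smooth family). -/
structure LamRegular (Ω : Set (ℝ × ℝ)) (g : 𝕜 → ℝ → ℝ → 𝕜) (μ₀ : 𝕜) : Prop where
  xdiff : XDiff 2 Ω (dlam g μ₀)
  tdiff : TDiff Ω (dlam g μ₀)
  tdiff_dx : TDiff Ω (dx (dlam g μ₀))
  lam : ∀ p ∈ Ω, HasDerivAt (fun μ => g μ p.1 p.2) (dlam g μ₀ p.1 p.2) μ₀
  lam_dx : ∀ p ∈ Ω, HasDerivAt (fun μ => dx (g μ) p.1 p.2) (dx (dlam g μ₀) p.1 p.2) μ₀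
  lam_dxx : ∀ p ∈ Ω,
    HasDerivAt (fun μ => dx (dx (g μ)) p.1 p.2) (dx (dx (dlam g μ₀)) p.1 p.2) μ₀
  lam_dt : ∀ p ∈ Ω, HasDerivAt (fun μ => dt (g μ) p.1 p.2) (dt (dlam g μ₀) p.1 p.2) μ₀
  lam_dtx : ∀ p ∈ Ω,
    HasDerivAt (fun μ => dt (dx (g μ)) p.1 p.2) (dt (dx (dlam g μ₀)) p.1 p.2) μ₀

/-- The input of the second type of Darboux transformation: a solution `u, φ₁, …, φₙ` of the
KdV equation with sources, a further spectral value `μ₀`, a solution `f` of the Lax pair for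
`μ₀`, a family `g μ` of solutions of the Lax pair for `μ` near `μ₀`, with nonzero Wronskian
`W(f, g)`, a differentiable function `C` of time, and a square root `s` of `C_t / W(f, g)`. -/
structure DarbouxInput {n : ℕ} (Ω : Set (ℝ × ℝ)) (lam : Fin n → 𝕜) (u : ℝ → ℝ → 𝕜)
    (φ : Fin n → ℝ → ℝ → 𝕜) (μ₀ : 𝕜) (f : ℝ → ℝ → 𝕜) (g : 𝕜 → ℝ → ℝ → 𝕜)
    (C s : ℝ → 𝕜) : Prop where
  isOpen : IsOpen Ω
  kdves : IsKdVES Ω lam u φ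
  ne_lam : ∀ j, μ₀ ≠ lam j
  lax_f : IsLax Ω lam u φ μ₀ f
  lax_g : ∀ᶠ μ in 𝓝 μ₀, IsLax Ω lam u φ μ (g μ)
  regular_g : LamRegular Ω g μ₀
  wronskian_ne : ∀ p ∈ Ω, wronskian ![f, g μ₀] p.1 p.2 ≠ 0
  C_diff : ∀ p ∈ Ω, DifferentiableAt ℝ C p.2
  s_sq : ∀ p ∈ Ω, s p.2 ^ 2 = deriv C p.2 / wronskian ![f, g μ₀] p.1 p.2

/-- `T = C(t) f + ∂_λ g`, at the spectral value `μ₀`. -/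
def darbouxT (C : ℝ → 𝕜) (f : ℝ → ℝ → 𝕜) (g : 𝕜 → ℝ → ℝ → 𝕜) (μ₀ : 𝕜) : ℝ → ℝ → 𝕜 :=
  fun x t => C t * f x t + dlam g μ₀ x t

/-- `W(g, T, F) / W(g, T)`. -/
def darbouxPsi (g T F : ℝ → ℝ → 𝕜) : ℝ → ℝ → 𝕜 :=
  fun x t => wronskian ![g, T, F] x t / wronskian ![g, T] x t

/-- `u + 2 ∂ₓ² ln W(g, T)`. -/
def darbouxU (u g T : ℝ → ℝ → 𝕜) : ℝ → ℝ → 𝕜 :=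
  fun x t => u x t + 2 * dxxLog (wronskian ![g, T]) x t

/-- The `n + 1` transformed sources; the last one is the new one. -/
def darbouxPhi {n : ℕ} (lam : Fin n → 𝕜) (φ : Fin n → ℝ → ℝ → 𝕜) (μ₀ : 𝕜)
    (f g T : ℝ → ℝ → 𝕜) (s : ℝ → 𝕜) : Fin (n + 1) → ℝ → ℝ → 𝕜 :=
  Fin.snoc (α := fun _ => ℝ → ℝ → 𝕜)
    (fun j x t => 1 / (lam j - μ₀) * darbouxPsi g T (φ j) x t)
    (fun x t => s t * darbouxPsi g T f x t)

/-- The points of `Ω` at which the transformed functions are defined. -/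
def darbouxDomain (Ω : Set (ℝ × ℝ)) (g T : ℝ → ℝ → 𝕜) : Set (ℝ × ℝ) :=
  {p | p ∈ Ω ∧ wronskian ![g, T] p.1 p.2 ≠ 0}

/-- The phase `Θ` of the positon solution. -/
def positonPhase (η b : ℝ → ℝ) (k x t : ℝ) : ℝ := k * x + 4 * k ^ 3 * t - η t / k + b k

/-- The function `γ = C + ∂_k Θ / (2k)` of the positon solution. -/
def positonGamma (η b C : ℝ → ℝ) (k x t : ℝ) : ℝ :=
  C t + 1 / (2 * k) * deriv (fun κ => positonPhase η b κ x t) k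

/-- The positon potential. -/
def positonU (η b C : ℝ → ℝ) (k x t : ℝ) : ℝ :=
  32 * k ^ 2 * (2 * k ^ 2 * positonGamma η b C k x t * Real.cos (positonPhase η b k x t)
      - Real.sin (positonPhase η b k x t)) * Real.sin (positonPhase η b k x t)
    / (4 * k ^ 2 * positonGamma η b C k x t - Real.sin (2 * positonPhase η b k x t)) ^ 2

/-- The two sources of the positon solution. -/
def positonPhi (η b C : ℝ → ℝ) (k : ℝ) : Fin 2 → ℝ → ℝ → ℝ :=
  ![fun x t => -√(deriv η t)
      * (4 * k ^ 2 * positonGamma η b C k x t + Real.sin (2 * positonPhase η b k x t))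
      / (4 * k ^ 2 * positonGamma η b C k x t - Real.sin (2 * positonPhase η b k x t)),
    fun x t => 4 * k * √(k * deriv C t) * Real.sin (positonPhase η b k x t)
      / (4 * k ^ 2 * positonGamma η b C k x t - Real.sin (2 * positonPhase η b k x t))]

/-- The phase `Θ` of the negaton solution. -/
def negatonPhase (η b : ℝ → ℝ) (k x t : ℝ) : ℝ := k * x - 4 * k ^ 3 * t + η t / k + b k

/-- The function `γ = C - ∂_k Θ / (2k)` of the negaton solution. -/
def negatonGamma (η b C : ℝ → ℝ) (k x t : ℝ) : ℝ :=
  C t - 1 / (2 * k) * deriv (fun κ => negatonPhase η b κ x t) k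

/-- The negaton potential. -/
def negatonU (η b C : ℝ → ℝ) (k x t : ℝ) : ℝ :=
  8 * k ^ 2 * (2 * k ^ 2 * negatonGamma η b C k x t * Real.cosh (negatonPhase η b k x t)
      + Real.sinh (negatonPhase η b k x t)) * Real.sinh (negatonPhase η b k x t)
    / (2 * k ^ 2 * negatonGamma η b C k x t
      + Real.sinh (negatonPhase η b k x t) * Real.cosh (negatonPhase η b k x t)) ^ 2

/-- The two sources of the negaton solution. -/
def negatonPhi (η b C : ℝ → ℝ) (k : ℝ) : Fin 2 → ℝ → ℝ → ℝ :=
  ![fun x t => √(deriv η t)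
      * (-(2 * k ^ 2 * negatonGamma η b C k x t)
        + Real.sinh (negatonPhase η b k x t) * Real.cosh (negatonPhase η b k x t))
      / (2 * k ^ 2 * negatonGamma η b C k x t
        + Real.sinh (negatonPhase η b k x t) * Real.cosh (negatonPhase η b k x t)),
    fun x t => 2 * k * √(k * deriv C t) * Real.sinh (negatonPhase η b k x t)
      / (2 * k ^ 2 * negatonGamma η b C k x t
        + Real.sinh (negatonPhase η b k x t) * Real.cosh (negatonPhase η b k x t))]

end KdVES

end

/-!
Everything is expressed through `W = W(g, T)` and the `2 × 2` Wronskians with `g`.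

The derivative of the Schrödinger equation in the spectral parameter gives `T_xx = -(μ₀ + u) T - g`,
hence `W_x = -g ^ 2`. So `ũ = u - 2 (g ^ 2 / W)_x`, and for a solution `F` of the Schrödinger
equation with spectral value `μ` the quotient `W(g, T, F) / W` equals `(μ₀ - μ) F + g W(g, F) / W`
(`DarbouxInput.darbouxU_eq`, `DarbouxInput.darbouxPsi_eq`). That these functions solve the
transformed Schrödinger equation only uses `W_x = -g ^ 2` (`IsSeed.dressed_isSchr`); it covers the
wave functions, the old sources and the new one.

For the time evolution, two solutions of the Lax pair satisfy `W(ψ, χ)_x = (μ - ν) ψ χ` and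
`W(ψ, χ)_t = (μ - ν) flux`, where `flux` is bilinear and contains the sources as
`∑ W(ψ, φ_j) W(χ, φ_j) / ((μ - λ_j) (ν - λ_j))` (`wr_hasMixed`). Taking `ψ = g` and differentiating
in the spectral value `ν` of `χ` at the zero `μ₀` of the factor `μ₀ - ν` gives
`W(g, ∂_λ g)_t = -flux`, and so `W_t = -C_t W(f, g) - flux`
(`DarbouxInput.wr_darbouxT_hasMixed`). In `(g ^ 2 / W)_t = -(W_t / W)_x` the sources then appear
exactly as the difference of the sums of squares of new and old sources, the new one
`s W(g, T, f) / W` coming from the term with `C_t` (`DarbouxInput.sqDiv_dt_eq`); one more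
`x`-derivative is the transformed evolution equation. The evolution of the transformed wave
functions is an algebraic identity in the functions and their first derivatives
(`DarbouxInput.dressed_dt_eq`).

Positon and negaton are treated together through a sign `σ`, with `(sin, cos)` or `(sinh, cosh)`
replaced by a pair with `S' = c`, `c' = -σ S`, `c ^ 2 + σ S ^ 2 = 1`
(`IsWavePair.darboux_transform`). There `T = γ c(Θ)` and `-2 k W = 2 k ^ 2 γ - σ S(Θ) c(Θ)`.
-/

noncomputable section

namespace KdVES

variable {𝕜 : Type*} [RCLike 𝕜]

/-! ### Calculus along coordinate lines -/

/-- `Ω` meets every horizontal and every vertical line in a relatively open set. The domain of the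
transformed functions is only known to be open in this weaker sense, because a Wronskian that is
differentiable in each variable separately need not be continuous. -/
structure LineOpen (Ω : Set (ℝ × ℝ)) : Prop where
  horizontal : ∀ x t, (x, t) ∈ Ω → ∀ᶠ y in 𝓝 x, (y, t) ∈ Ω
  vertical : ∀ x t, (x, t) ∈ Ω → ∀ᶠ s in 𝓝 t, (x, s) ∈ Ω

lemma _root_.IsOpen.lineOpen {Ω : Set (ℝ × ℝ)} (h : IsOpen Ω) : LineOpen Ω where
  horizontal x t hp := (h.preimage (by fun_prop : Continuous fun y : ℝ => (y, t))).mem_nhds hp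
  vertical x t hp := (h.preimage (by fun_prop : Continuous fun s : ℝ => (x, s))).mem_nhds hp

/-- On `Ω`, the function `F` has the partial derivative `F'` in `x`. -/
def HasDx (Ω : Set (ℝ × ℝ)) (F F' : ℝ → ℝ → 𝕜) : Prop :=
  ∀ x t, (x, t) ∈ Ω → HasDerivAt (fun y => F y t) (F' x t) x

/-- On `Ω`, the function `F` has the partial derivative `F'` in `t`. -/
def HasDt (Ω : Set (ℝ × ℝ)) (F F' : ℝ → ℝ → 𝕜) : Prop :=
  ∀ x t, (x, t) ∈ Ω → HasDerivAt (fun s => F x s) (F' x t) t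

variable {Ω Ω' : Set (ℝ × ℝ)} {F F' G G' : ℝ → ℝ → 𝕜}

lemma HasDx.dx_eq (h : HasDx Ω F F') {x t : ℝ} (hp : (x, t) ∈ Ω) : dx F x t = F' x t :=
  (h x t hp).deriv

lemma HasDt.dt_eq (h : HasDt Ω F F') {x t : ℝ} (hp : (x, t) ∈ Ω) : dt F x t = F' x t :=
  (h x t hp).deriv

lemma HasDx.mono (h : HasDx Ω F F') (hs : Ω' ⊆ Ω) : HasDx Ω' F F' :=
  fun x t hp => h x t (hs hp)

lemma HasDt.mono (h : HasDt Ω F F') (hs : Ω' ⊆ Ω) : HasDt Ω' F F' :=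
  fun x t hp => h x t (hs hp)

lemma HasDx.congr (h : HasDx Ω F F') (hΩ : LineOpen Ω)
    (h₀ : ∀ x t, (x, t) ∈ Ω → G x t = F x t) (h₁ : ∀ x t, (x, t) ∈ Ω → G' x t = F' x t) :
    HasDx Ω G G' := fun x t hp => by
  rw [h₁ x t hp]
  exact (h x t hp).congr_of_eventuallyEq
    ((hΩ.horizontal x t hp).mono fun y hy => h₀ y t hy)

lemma HasDt.congr (h : HasDt Ω F F') (hΩ : LineOpen Ω)
    (h₀ : ∀ x t, (x, t) ∈ Ω → G x t = F x t) (h₁ : ∀ x t, (x, t) ∈ Ω → G' x t = F' x t) :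
    HasDt Ω G G' := fun x t hp => by
  rw [h₁ x t hp]
  exact (h x t hp).congr_of_eventuallyEq
    ((hΩ.vertical x t hp).mono fun y hy => h₀ x y hy)

lemma dx_congr (hΩ : LineOpen Ω) (h₀ : ∀ x t, (x, t) ∈ Ω → G x t = F x t) :
    ∀ x t, (x, t) ∈ Ω → dx G x t = dx F x t := fun x t hp =>
  Filter.EventuallyEq.deriv_eq ((hΩ.horizontal x t hp).mono fun y hy => h₀ y t hy)

lemma dt_congr (hΩ : LineOpen Ω) (h₀ : ∀ x t, (x, t) ∈ Ω → G x t = F x t) :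
    ∀ x t, (x, t) ∈ Ω → dt G x t = dt F x t := fun x t hp =>
  Filter.EventuallyEq.deriv_eq ((hΩ.vertical x t hp).mono fun y hy => h₀ x y hy)

lemma xdiff_one_iff : XDiff 1 Ω F ↔ HasDx Ω F (dx F) := by
  constructor
  · intro h x t hp
    simpa [dx] using (h (x, t) hp 0 one_pos).hasDerivAt
  · intro h p hp i hi
    obtain rfl : i = 0 := by omega
    simpa using (h p.1 p.2 hp).differentiableAt

lemma xdiff_succ_iff (k : ℕ) : XDiff (k + 1) Ω F ↔ XDiff 1 Ω F ∧ XDiff k Ω (dx F) := by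
  constructor
  · intro h
    refine ⟨fun p hp i hi => h p hp i (by omega), fun p hp i hi => ?_⟩
    have := h p hp (i + 1) (by omega)
    rwa [iteratedDeriv_succ'] at this
  · rintro ⟨h₁, h₂⟩ p hp i hi
    cases i with
    | zero => exact h₁ p hp 0 one_pos
    | succ i =>
      rw [iteratedDeriv_succ']
      exact h₂ p hp i (by omega)

lemma XDiff.hasDx {k : ℕ} (h : XDiff (k + 1) Ω F) : HasDx Ω F (dx F) :=
  xdiff_one_iff.1 ((xdiff_succ_iff k).1 h).1

lemma XDiff.dx {k : ℕ} (h : XDiff (k + 1) Ω F) : XDiff k Ω (dx F) :=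
  ((xdiff_succ_iff k).1 h).2

lemma XDiff.congr {k : ℕ} (h : XDiff k Ω F) (hΩ : LineOpen Ω)
    (h₀ : ∀ x t, (x, t) ∈ Ω → G x t = F x t) : XDiff k Ω G := by
  intro p hp i hi
  refine (h p hp i hi).congr_of_eventuallyEq ?_
  have h₁ : (fun y => G y p.2) =ᶠ[𝓝 p.1] fun y => F y p.2 :=
    (hΩ.horizontal p.1 p.2 hp).mono fun y hy => h₀ y p.2 hy
  exact h₁.eventuallyEq_nhds.mono fun y hy => hy.iteratedDeriv_eq i

lemma HasDx.xdiff_one (h : HasDx Ω F F') : XDiff 1 Ω F :=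
  xdiff_one_iff.2 fun x t hp => (h x t hp).differentiableAt.hasDerivAt

lemma HasDx.xdiff_succ {k : ℕ} (h : HasDx Ω F F') (hΩ : LineOpen Ω) (h' : XDiff k Ω F') :
    XDiff (k + 1) Ω F :=
  (xdiff_succ_iff k).2 ⟨h.xdiff_one, h'.congr hΩ fun _ _ hp => h.dx_eq hp⟩

lemma TDiff.hasDt (h : TDiff Ω F) : HasDt Ω F (dt F) :=
  fun x t hp => (h (x, t) hp).hasDerivAt

lemma HasDt.tdiff (h : HasDt Ω F F') : TDiff Ω F :=
  fun p hp => (h p.1 p.2 hp).differentiableAt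

lemma TDiff.congr (h : TDiff Ω F) (hΩ : LineOpen Ω)
    (h₀ : ∀ x t, (x, t) ∈ Ω → G x t = F x t) : TDiff Ω G :=
  (h.hasDt.congr hΩ h₀ fun _ _ _ => rfl).tdiff

/-- On `Ω`, the function `F` has the first derivatives `Fx`, `Ft`, and both mixed second
derivatives exist and equal `Fxt`. -/
structure HasMixed (Ω : Set (ℝ × ℝ)) (F Fx Ft Fxt : ℝ → ℝ → 𝕜) : Prop where
  x : HasDx Ω F Fx
  t : HasDt Ω F Ft
  xt : HasDt Ω Fx Fxt
  tx : HasDx Ω Ft Fxt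

variable {Fx Ft Fxt Gx Gt Gxt : ℝ → ℝ → 𝕜}

lemma HasMixed.mono (h : HasMixed Ω F Fx Ft Fxt) (hs : Ω' ⊆ Ω) : HasMixed Ω' F Fx Ft Fxt :=
  ⟨h.x.mono hs, h.t.mono hs, h.xt.mono hs, h.tx.mono hs⟩

lemma HasMixed.add (hF : HasMixed Ω F Fx Ft Fxt) (hG : HasMixed Ω G Gx Gt Gxt) :
    HasMixed Ω (fun x t => F x t + G x t) (fun x t => Fx x t + Gx x t)
      (fun x t => Ft x t + Gt x t) (fun x t => Fxt x t + Gxt x t) where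
  x x t hp := (hF.x x t hp).add (hG.x x t hp)
  t x t hp := (hF.t x t hp).add (hG.t x t hp)
  xt x t hp := (hF.xt x t hp).add (hG.xt x t hp)
  tx x t hp := (hF.tx x t hp).add (hG.tx x t hp)

lemma HasMixed.const_mul (hF : HasMixed Ω F Fx Ft Fxt) (c : 𝕜) :
    HasMixed Ω (fun x t => c * F x t) (fun x t => c * Fx x t)
      (fun x t => c * Ft x t) (fun x t => c * Fxt x t) where
  x x t hp := (hF.x x t hp).const_mul c
  t x t hp := (hF.t x t hp).const_mul c
  xt x t hp := (hF.xt x t hp).const_mul c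
  tx x t hp := (hF.tx x t hp).const_mul c

lemma HasMixed.mul (hF : HasMixed Ω F Fx Ft Fxt) (hG : HasMixed Ω G Gx Gt Gxt) :
    HasMixed Ω (fun x t => F x t * G x t) (fun x t => Fx x t * G x t + F x t * Gx x t)
      (fun x t => Ft x t * G x t + F x t * Gt x t)
      (fun x t => Fxt x t * G x t + Fx x t * Gt x t + Ft x t * Gx x t + F x t * Gxt x t) where
  x x t hp := (hF.x x t hp).mul (hG.x x t hp)
  t x t hp := (hF.t x t hp).mul (hG.t x t hp)
  xt x t hp := (((hF.xt x t hp).mul (hG.t x t hp)).add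
    ((hF.t x t hp).mul (hG.xt x t hp))).congr_deriv (by ring)
  tx x t hp := (((hF.tx x t hp).mul (hG.x x t hp)).add
    ((hF.x x t hp).mul (hG.tx x t hp))).congr_deriv (by ring)

lemma HasMixed.inv (hF : HasMixed Ω F Fx Ft Fxt) (h₀ : ∀ x t, (x, t) ∈ Ω → F x t ≠ 0) :
    HasMixed Ω (fun x t => (F x t)⁻¹) (fun x t => -Fx x t / F x t ^ 2)
      (fun x t => -Ft x t / F x t ^ 2)
      (fun x t => -Fxt x t / F x t ^ 2 + 2 * Fx x t * Ft x t / F x t ^ 3) where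
  x x t hp := (hF.x x t hp).inv (h₀ x t hp)
  t x t hp := (hF.t x t hp).inv (h₀ x t hp)
  xt x t hp := by
    have h := h₀ x t hp
    refine ((hF.xt x t hp).neg.div ((hF.t x t hp).pow 2) (pow_ne_zero 2 h)).congr_deriv ?_
    simp only [Pi.pow_apply, Pi.neg_apply]
    field_simp
    push_cast
    ring
  tx x t hp := by
    have h := h₀ x t hp
    refine ((hF.tx x t hp).neg.div ((hF.x x t hp).pow 2) (pow_ne_zero 2 h)).congr_deriv ?_
    simp only [Pi.pow_apply, Pi.neg_apply]
    field_simp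
    push_cast
    ring

/-! ### Wronskians -/

lemma wronskian_two (a b : ℝ → ℝ → 𝕜) (x t : ℝ) :
    wronskian ![a, b] x t = a x t * dx b x t - dx a x t * b x t := by
  simp [wronskian, Matrix.det_fin_two, dx, mul_comm]

lemma wronskian_three (a b c : ℝ → ℝ → 𝕜) (x t : ℝ) :
    wronskian ![a, b, c] x t =
      dx (dx c) x t * (a x t * dx b x t - dx a x t * b x t)
        - dx c x t * (a x t * dx (dx b) x t - dx (dx a) x t * b x t)
        + c x t * (dx a x t * dx (dx b) x t - dx (dx a) x t * dx b x t) := by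
  have h (F : ℝ → ℝ → 𝕜) : iteratedDeriv 2 (fun y => F y t) x = dx (dx F) x t := by
    rw [iteratedDeriv_succ, iteratedDeriv_one]; rfl
  simp [wronskian, Matrix.det_fin_three, h]
  simp only [dx]
  ring

end KdVES

namespace KdVES

variable {𝕜 : Type*} [RCLike 𝕜] {n : ℕ} {Ω : Set (ℝ × ℝ)} {lam : Fin n → 𝕜}
  {u : ℝ → ℝ → 𝕜} {φ : Fin n → ℝ → ℝ → 𝕜} {μ ν : 𝕜} {ψ χ : ℝ → ℝ → 𝕜}

/-! ### Solutions of the Lax pair -/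

/-- The Wronskian `W(F, G) = F G_x - F_x G` of two functions. -/
def wr (F G : ℝ → ℝ → 𝕜) : ℝ → ℝ → 𝕜 := fun x t => F x t * dx G x t - dx F x t * G x t

lemma wr_swap (F G : ℝ → ℝ → 𝕜) (x t : ℝ) : wr F G x t = -wr G F x t := by
  simp only [wr]
  ring

/-- On `Ω`, the function `ψ` satisfies `ψ_xx + (μ + u) ψ = 0`. -/
structure IsSchr (Ω : Set (ℝ × ℝ)) (u : ℝ → ℝ → 𝕜) (μ : 𝕜) (ψ : ℝ → ℝ → 𝕜) : Prop where
  d₁ : HasDx Ω ψ (dx ψ)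
  d₂ : HasDx Ω (dx ψ) fun x t => -(μ + u x t) * ψ x t

lemma IsSchr.mono {Ω' : Set (ℝ × ℝ)} (h : IsSchr Ω u μ ψ) (hs : Ω' ⊆ Ω) : IsSchr Ω' u μ ψ :=
  ⟨h.d₁.mono hs, h.d₂.mono hs⟩

lemma isSchr_of_xdiff (h : XDiff 2 Ω ψ)
    (h' : ∀ p ∈ Ω, dx (dx ψ) p.1 p.2 + (μ + u p.1 p.2) * ψ p.1 p.2 = 0) : IsSchr Ω u μ ψ where
  d₁ := h.hasDx
  d₂ x t hp := (h.dx.hasDx x t hp).congr_deriv (by linear_combination h' (x, t) hp)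

lemma IsLax.isSchr (h : IsLax Ω lam u φ μ ψ) : IsSchr Ω u μ ψ :=
  isSchr_of_xdiff h.xdiff h.schrodinger

lemma IsKdVES.isSchr (h : IsKdVES Ω lam u φ) (j : Fin n) : IsSchr Ω u (lam j) (φ j) :=
  isSchr_of_xdiff (h.φ_xdiff j) (h.schrodinger j)

/-- Two solutions of the Schrödinger equation satisfy `W(ψ, χ)_x = (μ - ν) ψ χ`. -/
lemma IsSchr.wr (h : IsSchr Ω u μ ψ) (h' : IsSchr Ω u ν χ) :
    HasDx Ω (wr ψ χ) fun x t => (μ - ν) * (ψ x t * χ x t) := fun x t hp =>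
  (((h.d₁ x t hp).mul (h'.d₂ x t hp)).sub ((h.d₂ x t hp).mul (h'.d₁ x t hp))).congr_deriv
    (by ring)

lemma IsLax.dt_eq (h : IsLax Ω lam u φ μ ψ) {x t : ℝ} (hp : (x, t) ∈ Ω) :
    dt ψ x t = dx u x t * ψ x t + (4 * μ - 2 * u x t) * dx ψ x t
      + ∑ j, 1 / (μ - lam j) * (φ j x t * wr ψ (φ j) x t) := by
  rw [h.evolution (x, t) hp]
  congr 1
  refine Finset.sum_congr rfl fun j _ => ?_
  simp only [KdVES.wr]
  ring

/-- The mixed derivative of a solution of the Lax pair, in terms of `ψ` and `ψ_x`. -/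
lemma IsLax.dt_dx_eq (hΩ : LineOpen Ω) (hK : IsKdVES Ω lam u φ) (h : IsLax Ω lam u φ μ ψ)
    (hμ : ∀ j, μ ≠ lam j) {x t : ℝ} (hp : (x, t) ∈ Ω) :
    dt (dx ψ) x t = dx (dx u) x t * ψ x t - dx u x t * dx ψ x t
      - (4 * μ - 2 * u x t) * (μ + u x t) * ψ x t
      + ∑ j, (1 / (μ - lam j) * (dx (φ j) x t * wr ψ (φ j) x t) + φ j x t ^ 2 * ψ x t) := by
  rw [h.mixed (x, t) hp, dx_congr hΩ (fun x t hp => h.dt_eq hp) x t hp]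
  have hψ := h.isSchr
  have hsum : HasDerivAt (fun y => ∑ j, 1 / (μ - lam j) * (φ j y t * KdVES.wr ψ (φ j) y t))
      (∑ j, (1 / (μ - lam j) * (dx (φ j) x t * KdVES.wr ψ (φ j) x t)
        + φ j x t ^ 2 * ψ x t)) x := by
    refine HasDerivAt.fun_sum fun j _ => ?_
    have hj := sub_ne_zero.2 (hμ j)
    refine ((((hK.isSchr j).d₁ x t hp).mul (hψ.wr (hK.isSchr j) x t hp)).const_mul
      (1 / (μ - lam j))).congr_deriv ?_
    field_simp
  refine HasDerivAt.deriv ((((hK.u_xdiff.dx.hasDx x t hp).mul (hψ.d₁ x t hp)).add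
    ((((hK.u_xdiff.hasDx x t hp).const_mul 2).const_sub (4 * μ)).mul (hψ.d₂ x t hp))).add
    hsum |>.congr_deriv ?_)
  ring

/-- The bilinear flux of the density `ψ χ` of two solutions of the Lax pair with spectral values
`μ` and `ν`, see `flux_hasDx`. -/
def flux (lam : Fin n → 𝕜) (u : ℝ → ℝ → 𝕜) (φ : Fin n → ℝ → ℝ → 𝕜) (μ ν : 𝕜)
    (ψ χ : ℝ → ℝ → 𝕜) : ℝ → ℝ → 𝕜 := fun x t =>
  4 * (dx ψ x t * dx χ x t) + (4 * μ + 4 * ν + 2 * u x t) * (ψ x t * χ x t)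
    + ∑ j, 1 / ((μ - lam j) * (ν - lam j)) * (wr ψ (φ j) x t * wr χ (φ j) x t)

/-- The conservation law `(ψ χ)_t = flux_x`. -/
lemma flux_hasDx (hK : IsKdVES Ω lam u φ) (h : IsLax Ω lam u φ μ ψ)
    (h' : IsLax Ω lam u φ ν χ) (hμ : ∀ j, μ ≠ lam j) (hν : ∀ j, ν ≠ lam j) :
    HasDx Ω (flux lam u φ μ ν ψ χ) fun x t => dt ψ x t * χ x t + ψ x t * dt χ x t := by
  intro x t hp
  have hψ := h.isSchr
  have hχ := h'.isSchr
  have hsum : HasDerivAt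
      (fun y => ∑ j, 1 / ((μ - lam j) * (ν - lam j)) * (wr ψ (φ j) y t * wr χ (φ j) y t))
      (∑ j, (1 / (μ - lam j) * (φ j x t * wr ψ (φ j) x t) * χ x t
        + ψ x t * (1 / (ν - lam j) * (φ j x t * wr χ (φ j) x t)))) x := by
    refine HasDerivAt.fun_sum fun j _ => ?_
    have hj := sub_ne_zero.2 (hμ j)
    have hj' := sub_ne_zero.2 (hν j)
    refine (((hψ.wr (hK.isSchr j) x t hp).mul (hχ.wr (hK.isSchr j) x t hp)).const_mul
      (1 / ((μ - lam j) * (ν - lam j)))).congr_deriv ?_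
    field_simp
    ring
  refine (((((hψ.d₂ x t hp).mul (hχ.d₂ x t hp)).const_mul 4).add
    ((((hK.u_xdiff.hasDx x t hp).const_mul 2).const_add (4 * μ + 4 * ν)).mul
      ((hψ.d₁ x t hp).mul (hχ.d₁ x t hp)))).add hsum).congr_deriv ?_
  simp only [Pi.mul_apply]
  rw [h.dt_eq hp, h'.dt_eq hp, Finset.sum_add_distrib, ← Finset.sum_mul, ← Finset.mul_sum]
  ring

/-- The source terms of the two evolution equations combine because
`1 / (ν - λ_j) - 1 / (μ - λ_j) = (μ - ν) / ((μ - λ_j) (ν - λ_j))`. -/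
lemma wr_dt_eq (hΩ : LineOpen Ω) (hK : IsKdVES Ω lam u φ) (h : IsLax Ω lam u φ μ ψ)
    (h' : IsLax Ω lam u φ ν χ) (hμ : ∀ j, μ ≠ lam j) (hν : ∀ j, ν ≠ lam j) {x t : ℝ}
    (hp : (x, t) ∈ Ω) :
    dt ψ x t * dx χ x t + ψ x t * dt (dx χ) x t
      - (dt (dx ψ) x t * χ x t + dx ψ x t * dt χ x t) = (μ - ν) * flux lam u φ μ ν ψ χ x t := by
  have hsum : (∑ j, 1 / (μ - lam j) * (φ j x t * wr ψ (φ j) x t)) * dx χ x t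
      + ψ x t * ∑ j, (1 / (ν - lam j) * (dx (φ j) x t * wr χ (φ j) x t) + φ j x t ^ 2 * χ x t)
      - (∑ j, (1 / (μ - lam j) * (dx (φ j) x t * wr ψ (φ j) x t) + φ j x t ^ 2 * ψ x t)) * χ x t
      - dx ψ x t * ∑ j, 1 / (ν - lam j) * (φ j x t * wr χ (φ j) x t)
      = (μ - ν) *
        ∑ j, 1 / ((μ - lam j) * (ν - lam j)) * (wr ψ (φ j) x t * wr χ (φ j) x t) := by
    simp only [Finset.sum_mul, Finset.mul_sum, ← Finset.sum_add_distrib,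
      ← Finset.sum_sub_distrib]
    refine Finset.sum_congr rfl fun j _ => ?_
    have hj := sub_ne_zero.2 (hμ j)
    have hj' := sub_ne_zero.2 (hν j)
    simp only [wr]
    field_simp
    ring
  rw [h.dt_eq hp, h'.dt_eq hp, h.dt_dx_eq hΩ hK hμ hp, h'.dt_dx_eq hΩ hK hν hp, flux]
  linear_combination hsum

/-- For two solutions of the Lax pair, the Wronskian has `W(ψ, χ)_t = (μ - ν) flux`; in particular
it does not depend on time if `μ = ν`. -/
lemma wr_hasDt (hΩ : LineOpen Ω) (hK : IsKdVES Ω lam u φ) (h : IsLax Ω lam u φ μ ψ)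
    (h' : IsLax Ω lam u φ ν χ) (hμ : ∀ j, μ ≠ lam j) (hν : ∀ j, ν ≠ lam j) :
    HasDt Ω (wr ψ χ) fun x t => (μ - ν) * flux lam u φ μ ν ψ χ x t := fun x t hp =>
  (((h.tdiff.hasDt x t hp).mul (h'.tdiff_dx.hasDt x t hp)).sub
    ((h.tdiff_dx.hasDt x t hp).mul (h'.tdiff.hasDt x t hp))).congr_deriv
    (wr_dt_eq hΩ hK h h' hμ hν hp)

lemma IsLax.hasMixed (h : IsLax Ω lam u φ μ ψ) :
    HasMixed Ω ψ (dx ψ) (dt ψ) (dt (dx ψ)) where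
  x := h.xdiff.hasDx
  t := h.tdiff.hasDt
  xt := h.tdiff_dx.hasDt
  tx x t hp := by rw [h.mixed (x, t) hp]; exact h.xdiff_dt.hasDx x t hp

lemma wr_hasMixed (hΩ : LineOpen Ω) (hK : IsKdVES Ω lam u φ) (h : IsLax Ω lam u φ μ ψ)
    (h' : IsLax Ω lam u φ ν χ) (hμ : ∀ j, μ ≠ lam j) (hν : ∀ j, ν ≠ lam j) :
    HasMixed Ω (wr ψ χ) (fun x t => (μ - ν) * (ψ x t * χ x t))
      (fun x t => (μ - ν) * flux lam u φ μ ν ψ χ x t)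
      (fun x t => (μ - ν) * (dt ψ x t * χ x t + ψ x t * dt χ x t)) where
  x := h.isSchr.wr h'.isSchr
  t := wr_hasDt hΩ hK h h' hμ hν
  xt x t hp := ((h.tdiff.hasDt x t hp).mul (h'.tdiff.hasDt x t hp)).const_mul _
  tx x t hp := (flux_hasDx hK h h' hμ hν x t hp).const_mul _

end KdVES

namespace KdVES

variable {𝕜 : Type*} [RCLike 𝕜] {n : ℕ} {Ω : Set (ℝ × ℝ)} {lam : Fin n → 𝕜}
  {u : ℝ → ℝ → 𝕜} {φ : Fin n → ℝ → ℝ → 𝕜} {μ₀ : 𝕜} {f : ℝ → ℝ → 𝕜} {g : 𝕜 → ℝ → ℝ → 𝕜}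
  {C s : ℝ → 𝕜}

/-! ### The derivative in the spectral parameter and the function `T` -/

namespace DarbouxInput

lemma lineOpen (h : DarbouxInput Ω lam u φ μ₀ f g C s) : LineOpen Ω := h.isOpen.lineOpen

lemma lax_g₀ (h : DarbouxInput Ω lam u φ μ₀ f g C s) :
    IsLax Ω lam u φ μ₀ (g μ₀) :=
  h.lax_g.self_of_nhds

/-- The Schrödinger equation, differentiated in the spectral parameter. -/
lemma dlam_dx_dx (h : DarbouxInput Ω lam u φ μ₀ f g C s) {x t : ℝ} (hp : (x, t) ∈ Ω) :
    dx (dx (dlam g μ₀)) x t = -(μ₀ + u x t) * dlam g μ₀ x t - g μ₀ x t := by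
  have h₁ : HasDerivAt (fun μ => -(μ + u x t) * g μ x t)
      (-(1 : 𝕜) * g μ₀ x t + -(μ₀ + u x t) * dlam g μ₀ x t) μ₀ :=
    (((hasDerivAt_id μ₀).add_const (u x t)).neg).mul (h.regular_g.lam (x, t) hp)
  have h₂ : (fun μ => dx (dx (g μ)) x t) =ᶠ[𝓝 μ₀] fun μ => -(μ + u x t) * g μ x t :=
    h.lax_g.mono fun μ hμ => by linear_combination hμ.schrodinger (x, t) hp
  rw [(h.regular_g.lam_dxx (x, t) hp).unique (h₁.congr_of_eventuallyEq h₂)]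
  ring

/-- The identity `W(g, g^μ)_t = (μ₀ - μ) flux`, differentiated in `μ` at `μ₀`. -/
lemma wr_dlam_dt_eq (h : DarbouxInput Ω lam u φ μ₀ f g C s) {x t : ℝ} (hp : (x, t) ∈ Ω) :
    dt (g μ₀) x t * dx (dlam g μ₀) x t + g μ₀ x t * dt (dx (dlam g μ₀)) x t
      - (dt (dx (g μ₀)) x t * dlam g μ₀ x t + dx (g μ₀) x t * dt (dlam g μ₀) x t)
      = -flux lam u φ μ₀ μ₀ (g μ₀) (g μ₀) x t := by
  have hr := h.regular_g
  have h₁ := (((hr.lam_dx (x, t) hp).const_mul (dt (g μ₀) x t)).add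
    ((hr.lam_dtx (x, t) hp).const_mul (g μ₀ x t))).sub
    (((hr.lam (x, t) hp).const_mul (dt (dx (g μ₀)) x t)).add
      ((hr.lam_dt (x, t) hp).const_mul (dx (g μ₀) x t)))
  have h₂ : (fun μ => dt (g μ₀) x t * dx (g μ) x t + g μ₀ x t * dt (dx (g μ)) x t
      - (dt (dx (g μ₀)) x t * g μ x t + dx (g μ₀) x t * dt (g μ) x t)) =ᶠ[𝓝 μ₀]
      fun μ => (μ₀ - μ) * flux lam u φ μ₀ μ (g μ₀) (g μ) x t := by
    have hne : ∀ᶠ μ in 𝓝 μ₀, ∀ j, μ ≠ lam j :=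
      Filter.eventually_all.2 fun j => isOpen_ne.mem_nhds (h.ne_lam j)
    filter_upwards [h.lax_g, hne] with μ hμ hμ'
    exact wr_dt_eq h.lineOpen h.kdves h.lax_g₀ hμ h.ne_lam hμ' hp
  have h₃ : DifferentiableAt 𝕜 (fun μ => flux lam u φ μ₀ μ (g μ₀) (g μ) x t) μ₀ := by
    -- only the differentiability of the flux matters, its coefficient `μ₀ - μ` vanishes at `μ₀`
    have d₀ := (hr.lam (x, t) hp).differentiableAt
    have d₁ := (hr.lam_dx (x, t) hp).differentiableAt
    simp only at d₀ d₁
    have d₂ : ∀ j, DifferentiableAt 𝕜 (fun μ => 1 / ((μ₀ - lam j) * (μ - lam j))) μ₀ :=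
      fun j => (differentiableAt_const _).div (by fun_prop)
        (mul_ne_zero (sub_ne_zero.2 (h.ne_lam j)) (sub_ne_zero.2 (h.ne_lam j)))
    simp only [flux, wr]
    refine ((d₁.const_mul _).const_mul _).add
      (((by fun_prop : DifferentiableAt 𝕜
        (fun μ => 4 * μ₀ + 4 * μ + 2 * u x t) μ₀).mul (d₀.const_mul _))) |>.add ?_
    exact DifferentiableAt.fun_sum fun j _ => (d₂ j).mul
      (((d₀.mul_const _).sub (d₁.mul_const _)).const_mul _)
  have h₄ := ((hasDerivAt_id μ₀).const_sub μ₀).mul h₃.hasDerivAt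
  rw [h₁.unique (h₄.congr_of_eventuallyEq h₂)]
  simp

/-- `W(g, ∂_λ g)_x = -g ^ 2`. -/
lemma wr_dlam_hasDx (h : DarbouxInput Ω lam u φ μ₀ f g C s) :
    HasDx Ω (wr (g μ₀) (dlam g μ₀)) fun x t => -g μ₀ x t ^ 2 := by
  intro x t hp
  have hg := h.lax_g₀.isSchr
  refine (((hg.d₁ x t hp).mul (h.regular_g.xdiff.dx.hasDx x t hp)).sub
    ((hg.d₂ x t hp).mul (h.regular_g.xdiff.hasDx x t hp))).congr_deriv ?_
  rw [h.dlam_dx_dx hp]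
  ring

lemma wr_dlam_hasDt (h : DarbouxInput Ω lam u φ μ₀ f g C s) :
    HasDt Ω (wr (g μ₀) (dlam g μ₀)) fun x t => -flux lam u φ μ₀ μ₀ (g μ₀) (g μ₀) x t :=
  fun x t hp => (((h.lax_g₀.tdiff.hasDt x t hp).mul (h.regular_g.tdiff_dx.hasDt x t hp)).sub
    ((h.lax_g₀.tdiff_dx.hasDt x t hp).mul (h.regular_g.tdiff.hasDt x t hp))).congr_deriv
    (h.wr_dlam_dt_eq hp)

lemma darbouxT_dx_eq (h : DarbouxInput Ω lam u φ μ₀ f g C s) {x t : ℝ} (hp : (x, t) ∈ Ω) :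
    dx (darbouxT C f g μ₀) x t = C t * dx f x t + dx (dlam g μ₀) x t :=
  (((h.lax_f.isSchr.d₁ x t hp).const_mul (C t)).add
    (h.regular_g.xdiff.hasDx x t hp)).deriv

lemma darbouxT_dx_dx_eq (h : DarbouxInput Ω lam u φ μ₀ f g C s) {x t : ℝ} (hp : (x, t) ∈ Ω) :
    dx (dx (darbouxT C f g μ₀)) x t
      = -(μ₀ + u x t) * darbouxT C f g μ₀ x t - g μ₀ x t := by
  rw [dx_congr h.lineOpen (fun x t hp => h.darbouxT_dx_eq hp) x t hp]
  refine HasDerivAt.deriv ((((h.lax_f.isSchr.d₂ x t hp).const_mul (C t)).add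
    (h.regular_g.xdiff.dx.hasDx x t hp)).congr_deriv ?_)
  rw [h.dlam_dx_dx hp, darbouxT]
  ring

/-- The Wronskian `W = W(g, T)` has `W_x = -g ^ 2` and `W_t = -C_t W(f, g) - flux`. -/
lemma wr_darbouxT_hasMixed (h : DarbouxInput Ω lam u φ μ₀ f g C s) :
    HasMixed Ω (wr (g μ₀) (darbouxT C f g μ₀)) (fun x t => -g μ₀ x t ^ 2)
      (fun x t => -(deriv C t * wr f (g μ₀) x t + flux lam u φ μ₀ μ₀ (g μ₀) (g μ₀) x t))
      (fun x t => -(dt (g μ₀) x t * g μ₀ x t + g μ₀ x t * dt (g μ₀) x t)) := by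
  have hw : ∀ x t, (x, t) ∈ Ω → wr (g μ₀) (darbouxT C f g μ₀) x t
      = -(C t * wr f (g μ₀) x t) + wr (g μ₀) (dlam g μ₀) x t := fun x t hp => by
    simp only [wr, h.darbouxT_dx_eq hp]
    simp only [darbouxT]
    ring
  have hfx := h.lax_f.isSchr.wr h.lax_g₀.isSchr
  have hft := wr_hasDt h.lineOpen h.kdves h.lax_f h.lax_g₀ h.ne_lam h.ne_lam
  refine ⟨HasDx.congr (F' := fun x t => -g μ₀ x t ^ 2) (fun x t hp => ?_) h.lineOpen hw
    fun _ _ _ => rfl, HasDt.congr (F' := fun x t => -(deriv C t * wr f (g μ₀) x t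
      + flux lam u φ μ₀ μ₀ (g μ₀) (g μ₀) x t)) (fun x t hp => ?_) h.lineOpen hw
    fun _ _ _ => rfl, fun x t hp => ?_, fun x t hp => ?_⟩
  · refine ((((hfx x t hp).const_mul (C t)).neg).add (h.wr_dlam_hasDx x t hp)).congr_deriv ?_
    ring
  · refine ((((h.C_diff (x, t) hp).hasDerivAt.mul (hft x t hp)).neg).add
      (h.wr_dlam_hasDt x t hp)).congr_deriv ?_
    ring
  · refine ((h.lax_g₀.tdiff.hasDt x t hp).pow 2).neg.congr_deriv ?_
    push_cast
    ring
  · refine ((((hfx x t hp).const_mul (deriv C t)).add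
      (flux_hasDx h.kdves h.lax_g₀ h.lax_g₀ h.ne_lam h.ne_lam x t hp)).neg).congr_deriv ?_
    ring

/-- The Wronskian `W(g, T)` is continuous along coordinate lines. -/
lemma lineOpen_domain (h : DarbouxInput Ω lam u φ μ₀ f g C s) :
    LineOpen (darbouxDomain Ω (g μ₀) (darbouxT C f g μ₀)) := by
  have hW := h.wr_darbouxT_hasMixed
  have he : ∀ x t, wronskian ![g μ₀, darbouxT C f g μ₀] x t
      = wr (g μ₀) (darbouxT C f g μ₀) x t := wronskian_two _ _
  constructor
  · rintro x t ⟨hp, hne⟩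
    have hc := (hW.x x t hp).continuousAt.eventually_ne (he x t ▸ hne)
    filter_upwards [h.lineOpen.horizontal x t hp, hc] with y hy hy'
    exact ⟨hy, by rwa [he]⟩
  · rintro x t ⟨hp, hne⟩
    have hc := (hW.t x t hp).continuousAt.eventually_ne (he x t ▸ hne)
    filter_upwards [h.lineOpen.vertical x t hp, hc] with y hy hy'
    exact ⟨hy, by rwa [he]⟩

end DarbouxInput

end KdVES

namespace KdVES

variable {𝕜 : Type*} [RCLike 𝕜] {Ω : Set (ℝ × ℝ)} {u : ℝ → ℝ → 𝕜} {μ₀ μ : 𝕜}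
  {g W F : ℝ → ℝ → 𝕜}

/-! ### Dressing with a function `W` satisfying `W_x = -g ^ 2` -/

/-- A solution `g` of the Schrödinger equation and a nowhere vanishing function `W` with
`W_x = -g ^ 2`, which together define the transformed potential and wave functions. -/
structure IsSeed (Ω : Set (ℝ × ℝ)) (u : ℝ → ℝ → 𝕜) (μ₀ : 𝕜) (g W : ℝ → ℝ → 𝕜) : Prop where
  lineOpen : LineOpen Ω
  u_xdiff : XDiff 3 Ω u
  schr : IsSchr Ω u μ₀ g
  hasDx : HasDx Ω W fun x t => -g x t ^ 2
  ne_zero : ∀ x t, (x, t) ∈ Ω → W x t ≠ 0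

/-- The quotient `g ^ 2 / W`, which is `-(ln W)_x` if `W_x = -g ^ 2`. -/
def sqDiv (g W : ℝ → ℝ → 𝕜) : ℝ → ℝ → 𝕜 := fun x t => g x t ^ 2 / W x t

/-- The first `x`-derivative of `g ^ 2 / W`, given `W_x = -g ^ 2`. -/
def sqDiv₁ (g W : ℝ → ℝ → 𝕜) : ℝ → ℝ → 𝕜 := fun x t =>
  2 * g x t * dx g x t / W x t + g x t ^ 4 / W x t ^ 2

/-- The second `x`-derivative of `g ^ 2 / W`, given `W_x = -g ^ 2` and `g_xx = -(μ₀ + u) g`. -/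
def sqDiv₂ (u : ℝ → ℝ → 𝕜) (μ₀ : 𝕜) (g W : ℝ → ℝ → 𝕜) : ℝ → ℝ → 𝕜 := fun x t =>
  (2 * dx g x t ^ 2 - 2 * (μ₀ + u x t) * g x t ^ 2) / W x t
    + 6 * g x t ^ 3 * dx g x t / W x t ^ 2 + 2 * g x t ^ 6 / W x t ^ 3

/-- The third `x`-derivative of `g ^ 2 / W`, given `W_x = -g ^ 2` and `g_xx = -(μ₀ + u) g`. -/
def sqDiv₃ (u : ℝ → ℝ → 𝕜) (μ₀ : 𝕜) (g W : ℝ → ℝ → 𝕜) : ℝ → ℝ → 𝕜 := fun x t =>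
  (-8 * (μ₀ + u x t) * g x t * dx g x t - 2 * dx u x t * g x t ^ 2) / W x t
    + (20 * g x t ^ 2 * dx g x t ^ 2 - 8 * (μ₀ + u x t) * g x t ^ 4) / W x t ^ 2
    + 24 * g x t ^ 5 * dx g x t / W x t ^ 3 + 6 * g x t ^ 8 / W x t ^ 4

/-- The transformed potential `u - 2 (g ^ 2 / W)_x = u + 2 (ln W)_xx`. -/
def dressedU (u g W : ℝ → ℝ → 𝕜) : ℝ → ℝ → 𝕜 := fun x t => u x t - 2 * sqDiv₁ g W x t

/-- The transformed wave function `c F + g W(g, F) / W`, where `c` stands for the difference of the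
spectral values of `g` and `F`. -/
def dressed (g W : ℝ → ℝ → 𝕜) (c : 𝕜) (F : ℝ → ℝ → 𝕜) : ℝ → ℝ → 𝕜 := fun x t =>
  c * F x t + g x t * wr g F x t / W x t

/-- The `x`-derivative of the transformed wave function, given `W_x = -g ^ 2` and
`W(g, F)_x = c g F`. -/
def dressed₁ (g W : ℝ → ℝ → 𝕜) (c : 𝕜) (F : ℝ → ℝ → 𝕜) : ℝ → ℝ → 𝕜 := fun x t =>
  c * dx F x t + (dx g x t * wr g F x t + c * g x t ^ 2 * F x t) / W x t
    + g x t ^ 3 * wr g F x t / W x t ^ 2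

namespace IsSeed

lemma sqDiv_hasDx (h : IsSeed Ω u μ₀ g W) : HasDx Ω (sqDiv g W) (sqDiv₁ g W) := by
  intro x t hp
  have hW := h.ne_zero x t hp
  refine (((h.schr.d₁ x t hp).pow 2).div (h.hasDx x t hp) hW).congr_deriv ?_
  simp only [sqDiv₁, Pi.pow_apply]
  field_simp
  push_cast
  ring

lemma sqDiv₁_hasDx (h : IsSeed Ω u μ₀ g W) : HasDx Ω (sqDiv₁ g W) (sqDiv₂ u μ₀ g W) := by
  intro x t hp
  have hW := h.ne_zero x t hp
  have hg := h.schr.d₁ x t hp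
  have hg₁ := h.schr.d₂ x t hp
  have hWx := h.hasDx x t hp
  refine ((((hg.const_mul 2).mul hg₁).div hWx hW).add
    ((hg.pow 4).div (hWx.pow 2) (pow_ne_zero 2 hW))).congr_deriv ?_
  simp only [sqDiv₂, Pi.pow_apply, Pi.mul_apply]
  field_simp
  push_cast
  ring

lemma sqDiv₂_hasDx (h : IsSeed Ω u μ₀ g W) :
    HasDx Ω (sqDiv₂ u μ₀ g W) (sqDiv₃ u μ₀ g W) := by
  intro x t hp
  have hW := h.ne_zero x t hp
  have hg := h.schr.d₁ x t hp
  have hg₁ := h.schr.d₂ x t hp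
  have hWx := h.hasDx x t hp
  have hu := h.u_xdiff.hasDx x t hp
  refine ((((((hg₁.pow 2).const_mul 2).sub (((hu.const_add μ₀).const_mul 2).mul
    (hg.pow 2))).div hWx hW).add ((((hg.pow 3).const_mul 6).mul hg₁).div (hWx.pow 2)
    (pow_ne_zero 2 hW))).add (((hg.pow 6).const_mul 2).div (hWx.pow 3)
    (pow_ne_zero 3 hW))).congr_deriv ?_
  simp only [sqDiv₃, Pi.pow_apply, Pi.mul_apply, Pi.sub_apply]
  field_simp
  push_cast
  ring

lemma sqDiv₃_hasDx (h : IsSeed Ω u μ₀ g W) :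
    HasDx Ω (sqDiv₃ u μ₀ g W) (dx (sqDiv₃ u μ₀ g W)) := by
  intro x t hp
  have hW := h.ne_zero x t hp
  have hg := (h.schr.d₁ x t hp).differentiableAt
  have hg₁ := (h.schr.d₂ x t hp).differentiableAt
  have hWx := (h.hasDx x t hp).differentiableAt
  have hu := (h.u_xdiff.hasDx x t hp).differentiableAt
  have hu₁ := (h.u_xdiff.dx.hasDx x t hp).differentiableAt
  refine DifferentiableAt.hasDerivAt ?_
  unfold sqDiv₃
  refine (((DifferentiableAt.div ?_ hWx hW).add
    (DifferentiableAt.div ?_ (hWx.pow 2) (pow_ne_zero 2 hW))).add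
    (DifferentiableAt.div ?_ (hWx.pow 3) (pow_ne_zero 3 hW))).add
    (DifferentiableAt.div ?_ (hWx.pow 4) (pow_ne_zero 4 hW)) <;> fun_prop

lemma dressedU_hasDx (h : IsSeed Ω u μ₀ g W) :
    HasDx Ω (dressedU u g W) fun x t => dx u x t - 2 * sqDiv₂ u μ₀ g W x t :=
  fun x t hp => (h.u_xdiff.hasDx x t hp).sub ((h.sqDiv₁_hasDx x t hp).const_mul 2)

lemma dressedU_hasDx₂ (h : IsSeed Ω u μ₀ g W) :
    HasDx Ω (dx (dressedU u g W)) fun x t => dx (dx u) x t - 2 * sqDiv₃ u μ₀ g W x t :=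
  HasDx.congr (F := fun x t => dx u x t - 2 * sqDiv₂ u μ₀ g W x t)
    (fun x t hp => (h.u_xdiff.dx.hasDx x t hp).sub ((h.sqDiv₂_hasDx x t hp).const_mul 2))
    h.lineOpen (fun _ _ hp => h.dressedU_hasDx.dx_eq hp) fun _ _ _ => rfl

lemma dressedU_hasDx₃ (h : IsSeed Ω u μ₀ g W) :
    HasDx Ω (dx (dx (dressedU u g W)))
      fun x t => dx (dx (dx u)) x t - 2 * dx (sqDiv₃ u μ₀ g W) x t :=
  HasDx.congr (F := fun x t => dx (dx u) x t - 2 * sqDiv₃ u μ₀ g W x t)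
    (fun x t hp => (h.u_xdiff.dx.dx.hasDx x t hp).sub ((h.sqDiv₃_hasDx x t hp).const_mul 2))
    h.lineOpen (fun _ _ hp => h.dressedU_hasDx₂.dx_eq hp) fun _ _ _ => rfl

lemma dressedU_xdiff (h : IsSeed Ω u μ₀ g W) : XDiff 3 Ω (dressedU u g W) :=
  (xdiff_succ_iff 2).2 ⟨h.dressedU_hasDx.xdiff_one,
    (xdiff_succ_iff 1).2 ⟨h.dressedU_hasDx₂.xdiff_one, h.dressedU_hasDx₃.xdiff_one⟩⟩

lemma dressed_hasDx (h : IsSeed Ω u μ₀ g W) (hF : IsSchr Ω u μ F) :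
    HasDx Ω (dressed g W (μ₀ - μ) F) (dressed₁ g W (μ₀ - μ) F) := by
  intro x t hp
  have hW := h.ne_zero x t hp
  refine (((hF.d₁ x t hp).const_mul (μ₀ - μ)).add (((h.schr.d₁ x t hp).mul
    (h.schr.wr hF x t hp)).div (h.hasDx x t hp) hW)).congr_deriv ?_
  simp only [dressed₁, Pi.mul_apply]
  field_simp
  ring

/-- The transformed wave function solves the Schrödinger equation with the transformed potential
and the old spectral value. -/
lemma dressed_isSchr (h : IsSeed Ω u μ₀ g W) (hF : IsSchr Ω u μ F) :
    IsSchr Ω (dressedU u g W) μ (dressed g W (μ₀ - μ) F) where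
  d₁ x t hp := (h.dressed_hasDx hF x t hp).differentiableAt.hasDerivAt
  d₂ := by
    refine HasDx.congr (F := dressed₁ g W (μ₀ - μ) F) ?_ h.lineOpen
      (fun _ _ hp => (h.dressed_hasDx hF).dx_eq hp) fun _ _ _ => rfl
    intro x t hp
    have hW := h.ne_zero x t hp
    have hg := h.schr.d₁ x t hp
    have hg₁ := h.schr.d₂ x t hp
    have hw := h.schr.wr hF x t hp
    have hWx := h.hasDx x t hp
    refine ((((hF.d₂ x t hp).const_mul (μ₀ - μ)).add
      (((hg₁.mul hw).add (((hg.pow 2).const_mul (μ₀ - μ)).mul (hF.d₁ x t hp))).div hWx hW)).add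
      (((hg.pow 3).mul hw).div (hWx.pow 2) (pow_ne_zero 2 hW))).congr_deriv ?_
    simp only [dressedU, sqDiv₁, dressed, wr, Pi.mul_apply, Pi.pow_apply, Pi.add_apply]
    field_simp
    push_cast
    ring

end IsSeed

lemma IsSchr.const_mul (h : IsSchr Ω u μ F) (hΩ : LineOpen Ω) (c : ℝ → 𝕜) :
    IsSchr Ω u μ fun x t => c t * F x t where
  d₁ x t hp := ((h.d₁ x t hp).const_mul (c t)).differentiableAt.hasDerivAt
  d₂ := HasDx.congr (F := fun x t => c t * dx F x t)
    (F' := fun x t => c t * (-(μ + u x t) * F x t))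
    (fun x t hp => (h.d₂ x t hp).const_mul (c t)) hΩ
    (fun x t hp => ((h.d₁ x t hp).const_mul (c t)).deriv) fun x t _ => by ring

lemma IsSchr.xdiff (h : IsSchr Ω u μ F) : XDiff 2 Ω F :=
  (xdiff_succ_iff 1).2 ⟨h.d₁.xdiff_one, h.d₂.xdiff_one⟩

end KdVES

namespace KdVES

variable {𝕜 : Type*} [RCLike 𝕜] {n : ℕ} {Ω : Set (ℝ × ℝ)} {lam : Fin n → 𝕜}
  {u : ℝ → ℝ → 𝕜} {φ : Fin n → ℝ → ℝ → 𝕜} {μ₀ μ : 𝕜} {f : ℝ → ℝ → 𝕜}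
  {g : 𝕜 → ℝ → ℝ → 𝕜} {C s : ℝ → 𝕜} {ψ : ℝ → ℝ → 𝕜}

/-! ### The transformed solution -/

lemma IsKdVES.congr {u' : ℝ → ℝ → 𝕜} {φ' : Fin n → ℝ → ℝ → 𝕜} (h : IsKdVES Ω lam u φ)
    (hΩ : LineOpen Ω) (hu : ∀ x t, (x, t) ∈ Ω → u' x t = u x t)
    (hφ : ∀ j x t, (x, t) ∈ Ω → φ' j x t = φ j x t) : IsKdVES Ω lam u' φ' where
  u_xdiff := h.u_xdiff.congr hΩ hu
  u_tdiff := h.u_tdiff.congr hΩ hu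
  φ_xdiff j := (h.φ_xdiff j).congr hΩ (hφ j)
  evolution p hp := by
    have h₁ := dx_congr hΩ hu
    have h₂ := dx_congr hΩ (dx_congr hΩ h₁) p.1 p.2 hp
    have h₃ : dx (fun x t => ∑ j, φ' j x t ^ 2) p.1 p.2
        = dx (fun x t => ∑ j, φ j x t ^ 2) p.1 p.2 :=
      dx_congr hΩ (fun x t hp => Finset.sum_congr rfl fun j _ => by rw [hφ j x t hp]) p.1 p.2 hp
    rw [dt_congr hΩ hu p.1 p.2 hp, h₂, h₃, h₁ p.1 p.2 hp, hu p.1 p.2 hp]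
    exact h.evolution p hp
  schrodinger j p hp := by
    rw [dx_congr hΩ (dx_congr hΩ (hφ j)) p.1 p.2 hp, hu p.1 p.2 hp, hφ j p.1 p.2 hp]
    exact h.schrodinger j p hp

lemma IsLax.congr {u' : ℝ → ℝ → 𝕜} {φ' : Fin n → ℝ → ℝ → 𝕜} {ψ' : ℝ → ℝ → 𝕜}
    (h : IsLax Ω lam u φ μ ψ) (hΩ : LineOpen Ω) (hu : ∀ x t, (x, t) ∈ Ω → u' x t = u x t)
    (hφ : ∀ j x t, (x, t) ∈ Ω → φ' j x t = φ j x t) (hψ : ∀ x t, (x, t) ∈ Ω → ψ' x t = ψ x t) :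
    IsLax Ω lam u' φ' μ ψ' where
  xdiff := h.xdiff.congr hΩ hψ
  tdiff := h.tdiff.congr hΩ hψ
  tdiff_dx := h.tdiff_dx.congr hΩ (dx_congr hΩ hψ)
  xdiff_dt := h.xdiff_dt.congr hΩ (dt_congr hΩ hψ)
  mixed p hp := by
    rw [dt_congr hΩ (dx_congr hΩ hψ) p.1 p.2 hp, dx_congr hΩ (dt_congr hΩ hψ) p.1 p.2 hp]
    exact h.mixed p hp
  schrodinger p hp := by
    rw [dx_congr hΩ (dx_congr hΩ hψ) p.1 p.2 hp, hu p.1 p.2 hp, hψ p.1 p.2 hp]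
    exact h.schrodinger p hp
  evolution p hp := by
    rw [dt_congr hΩ hψ p.1 p.2 hp, dx_congr hΩ hu p.1 p.2 hp, dx_congr hΩ hψ p.1 p.2 hp,
      hu p.1 p.2 hp, hψ p.1 p.2 hp, h.evolution p hp]
    congr 1
    refine Finset.sum_congr rfl fun j _ => ?_
    rw [hφ j p.1 p.2 hp, dx_congr hΩ (hφ j) p.1 p.2 hp]

/-- The transformed sources, in terms of `W = W(g, T)`. -/
def dressedPhi (lam : Fin n → 𝕜) (φ : Fin n → ℝ → ℝ → 𝕜) (μ₀ : 𝕜) (f g W : ℝ → ℝ → 𝕜)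
    (s : ℝ → 𝕜) : Fin (n + 1) → ℝ → ℝ → 𝕜 :=
  Fin.snoc (α := fun _ => ℝ → ℝ → 𝕜)
    (fun j x t => 1 / (lam j - μ₀) * dressed g W (μ₀ - lam j) (φ j) x t)
    (fun x t => s t * dressed g W (μ₀ - μ₀) f x t)

@[simp] lemma dressedPhi_castSucc (g W : ℝ → ℝ → 𝕜) (j : Fin n) :
    dressedPhi lam φ μ₀ f g W s j.castSucc
      = fun x t => 1 / (lam j - μ₀) * dressed g W (μ₀ - lam j) (φ j) x t := by
  simp [dressedPhi]

@[simp] lemma dressedPhi_last (g W : ℝ → ℝ → 𝕜) :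
    dressedPhi lam φ μ₀ f g W s (Fin.last n)
      = fun x t => s t * dressed g W (μ₀ - μ₀) f x t := by
  simp [dressedPhi]

namespace DarbouxInput

lemma isSeed (h : DarbouxInput Ω lam u φ μ₀ f g C s) :
    IsSeed (darbouxDomain Ω (g μ₀) (darbouxT C f g μ₀)) u μ₀ (g μ₀)
      (wr (g μ₀) (darbouxT C f g μ₀)) where
  lineOpen := h.lineOpen_domain
  u_xdiff p hp := h.kdves.u_xdiff p hp.1
  schr := h.lax_g₀.isSchr.mono fun _ hp => hp.1
  hasDx := h.wr_darbouxT_hasMixed.x.mono fun _ hp => hp.1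
  ne_zero x t hp := by
    have := hp.2
    rwa [wronskian_two] at this

/-- The Wronskian formula for the potential is the dressing by `W(g, T)`. -/
lemma darbouxU_eq (h : DarbouxInput Ω lam u φ μ₀ f g C s) {x t : ℝ}
    (hp : (x, t) ∈ darbouxDomain Ω (g μ₀) (darbouxT C f g μ₀)) :
    darbouxU u (g μ₀) (darbouxT C f g μ₀) x t
      = dressedU u (g μ₀) (wr (g μ₀) (darbouxT C f g μ₀)) x t := by
  have hS := h.isSeed
  have he : wronskian ![g μ₀, darbouxT C f g μ₀] = wr (g μ₀) (darbouxT C f g μ₀) := by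
    funext x t
    exact wronskian_two _ _ x t
  have h₁ := (hS.sqDiv_hasDx x t hp).neg.deriv
  rw [darbouxU, dxxLog, he, dx_congr hS.lineOpen
    (F := fun x t => -sqDiv (g μ₀) (wr (g μ₀) (darbouxT C f g μ₀)) x t)
    (fun x t hp => ?_) x t hp]
  · simp only [dressedU]
    have h₂ : dx (fun x t => -sqDiv (g μ₀) (wr (g μ₀) (darbouxT C f g μ₀)) x t) x t
      = -sqDiv₁ (g μ₀) (wr (g μ₀) (darbouxT C f g μ₀)) x t := h₁
    rw [h₂]
    ring
  · rw [logDeriv_apply, (hS.hasDx x t hp).deriv, sqDiv, neg_div]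

/-- Eliminating second derivatives from the `3 × 3` Wronskian turns `W(g, T, F) / W(g, T)` into the
dressing by `W(g, T)`. -/
lemma darbouxPsi_eq {F : ℝ → ℝ → 𝕜} (h : DarbouxInput Ω lam u φ μ₀ f g C s)
    (hF : IsSchr Ω u μ F) {x t : ℝ}
    (hp : (x, t) ∈ darbouxDomain Ω (g μ₀) (darbouxT C f g μ₀)) :
    darbouxPsi (g μ₀) (darbouxT C f g μ₀) F x t
      = dressed (g μ₀) (wr (g μ₀) (darbouxT C f g μ₀)) (μ₀ - μ) F x t := by
  have hW := h.isSeed.ne_zero x t hp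
  rw [darbouxPsi, wronskian_two, wronskian_three, h.darbouxT_dx_dx_eq hp.1,
    HasDx.dx_eq hF.d₂ hp.1, HasDx.dx_eq h.lax_g₀.isSchr.d₂ hp.1, dressed]
  simp only [wr] at hW ⊢
  field_simp
  ring

lemma darbouxPhi_eq (h : DarbouxInput Ω lam u φ μ₀ f g C s) (j : Fin (n + 1)) {x t : ℝ}
    (hp : (x, t) ∈ darbouxDomain Ω (g μ₀) (darbouxT C f g μ₀)) :
    darbouxPhi lam φ μ₀ f (g μ₀) (darbouxT C f g μ₀) s j x t
      = dressedPhi lam φ μ₀ f (g μ₀) (wr (g μ₀) (darbouxT C f g μ₀)) s j x t := by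
  refine Fin.lastCases ?_ (fun j => ?_) j
  · simp only [darbouxPhi, Fin.snoc_last, dressedPhi_last]
    rw [h.darbouxPsi_eq h.lax_f.isSchr hp]
  · simp only [darbouxPhi, Fin.snoc_castSucc, dressedPhi_castSucc]
    rw [h.darbouxPsi_eq (h.kdves.isSchr j) hp]

/-- The normalisation of the new source. -/
lemma s_sq_mul (h : DarbouxInput Ω lam u φ μ₀ f g C s) {x t : ℝ} (hp : (x, t) ∈ Ω) :
    s t ^ 2 * wr f (g μ₀) x t = deriv C t := by
  have h₁ := h.wronskian_ne (x, t) hp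
  have h₂ := h.s_sq (x, t) hp
  simp only [wronskian_two] at h₁ h₂
  rw [h₂, wr, div_mul_cancel₀ _ h₁]

lemma dressedPhi_isSchr (h : DarbouxInput Ω lam u φ μ₀ f g C s) (j : Fin (n + 1)) :
    IsSchr (darbouxDomain Ω (g μ₀) (darbouxT C f g μ₀))
      (dressedU u (g μ₀) (wr (g μ₀) (darbouxT C f g μ₀)))
      (Fin.snoc (α := fun _ => 𝕜) lam μ₀ j : 𝕜)
      (dressedPhi lam φ μ₀ f (g μ₀) (wr (g μ₀) (darbouxT C f g μ₀)) s j) := by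
  have hS := h.isSeed
  refine Fin.lastCases ?_ (fun j => ?_) j
  · simp only [Fin.snoc_last, dressedPhi_last]
    exact (hS.dressed_isSchr (h.lax_f.isSchr.mono fun _ hp => hp.1)).const_mul hS.lineOpen s
  · simp only [Fin.snoc_castSucc, dressedPhi_castSucc]
    exact (hS.dressed_isSchr ((h.kdves.isSchr j).mono fun _ hp => hp.1)).const_mul hS.lineOpen
      fun _ => 1 / (lam j - μ₀)

/-- The time derivative of `g ^ 2 / W = -(ln W)_x`: the sources enter only through the change of the
sum of their squares. -/
lemma sqDiv_dt_eq (h : DarbouxInput Ω lam u φ μ₀ f g C s) {x t : ℝ}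
    {W : ℝ → ℝ → 𝕜} (hp : (x, t) ∈ Ω) (hW : W x t ≠ 0) :
    2 * g μ₀ x t * dt (g μ₀) x t / W x t
      + g μ₀ x t ^ 2 * (deriv C t * wr f (g μ₀) x t
        + flux lam u φ μ₀ μ₀ (g μ₀) (g μ₀) x t) / W x t ^ 2
      = -6 * u x t * sqDiv₁ (g μ₀) W x t + 6 * sqDiv₁ (g μ₀) W x t ^ 2
        - sqDiv₃ u μ₀ (g μ₀) W x t
        + (∑ j, dressedPhi lam φ μ₀ f (g μ₀) W s j x t ^ 2 - ∑ j, φ j x t ^ 2) := by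
  have hlast : (s t * dressed (g μ₀) W (μ₀ - μ₀) f x t) ^ 2
      = g μ₀ x t ^ 2 * (deriv C t * wr f (g μ₀) x t) / W x t ^ 2 := by
    rw [← h.s_sq_mul hp]
    simp only [dressed, wr]
    field_simp
    ring
  have hsum : (∑ j, (1 / (lam j - μ₀) * dressed (g μ₀) W (μ₀ - lam j) (φ j) x t) ^ 2)
        - ∑ j, φ j x t ^ 2
      = 2 * g μ₀ x t / W x t * (∑ j, 1 / (μ₀ - lam j) * (φ j x t * wr (g μ₀) (φ j) x t))
        + g μ₀ x t ^ 2 / W x t ^ 2 * ∑ j, 1 / ((μ₀ - lam j) * (μ₀ - lam j)) *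
          (wr (g μ₀) (φ j) x t * wr (g μ₀) (φ j) x t) := by
    rw [Finset.mul_sum, Finset.mul_sum, ← Finset.sum_add_distrib, ← Finset.sum_sub_distrib]
    refine Finset.sum_congr rfl fun j _ => ?_
    have hj := sub_ne_zero.2 (h.ne_lam j)
    have hj' : lam j - μ₀ = -(μ₀ - lam j) := by ring
    rw [hj', dressed]
    field_simp
    ring
  rw [Fin.sum_univ_castSucc]
  simp only [dressedPhi_castSucc, dressedPhi_last]
  rw [hlast, sub_eq_iff_eq_add.1 hsum, h.lax_g₀.dt_eq hp]
  simp only [flux, sqDiv₁, sqDiv₃]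
  generalize (∑ j, 1 / (μ₀ - lam j) * (φ j x t * wr (g μ₀) (φ j) x t)) = S₁
  generalize (∑ j, 1 / ((μ₀ - lam j) * (μ₀ - lam j)) *
    (wr (g μ₀) (φ j) x t * wr (g μ₀) (φ j) x t)) = S₂
  field_simp
  ring

/-- With `W = W(g, T)`, the formula of `sqDiv_dt_eq` gives the `t`-derivative of `g ^ 2 / W`, and
its mixed second derivatives agree. -/
lemma sqDiv_hasMixed (h : DarbouxInput Ω lam u φ μ₀ f g C s) :
    ∃ E, HasMixed (darbouxDomain Ω (g μ₀) (darbouxT C f g μ₀))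
      (sqDiv (g μ₀) (wr (g μ₀) (darbouxT C f g μ₀)))
      (sqDiv₁ (g μ₀) (wr (g μ₀) (darbouxT C f g μ₀)))
      (fun x t => -6 * u x t * sqDiv₁ (g μ₀) (wr (g μ₀) (darbouxT C f g μ₀)) x t
        + 6 * sqDiv₁ (g μ₀) (wr (g μ₀) (darbouxT C f g μ₀)) x t ^ 2
        - sqDiv₃ u μ₀ (g μ₀) (wr (g μ₀) (darbouxT C f g μ₀)) x t
        + (∑ j, dressedPhi lam φ μ₀ f (g μ₀) (wr (g μ₀) (darbouxT C f g μ₀)) s j x t ^ 2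
          - ∑ j, φ j x t ^ 2)) E := by
  have hS := h.isSeed
  have hs : darbouxDomain Ω (g μ₀) (darbouxT C f g μ₀) ⊆ Ω := fun _ hp => hp.1
  have hg := h.lax_g₀.hasMixed.mono hs
  have hW := h.wr_darbouxT_hasMixed.mono hs
  have hy := (hg.mul hg).mul (hW.inv hS.ne_zero)
  have h₀ : ∀ x t, (x, t) ∈ darbouxDomain Ω (g μ₀) (darbouxT C f g μ₀) →
      sqDiv (g μ₀) (wr (g μ₀) (darbouxT C f g μ₀)) x t
        = g μ₀ x t * g μ₀ x t * (wr (g μ₀) (darbouxT C f g μ₀) x t)⁻¹ := fun x t hp => by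
    rw [sqDiv]; ring
  refine ⟨_, hS.sqDiv_hasDx, hy.t.congr hS.lineOpen h₀ fun x t hp => ?_,
    hy.xt.congr hS.lineOpen (fun x t hp => ?_) fun _ _ _ => rfl,
    hy.tx.congr hS.lineOpen (fun x t hp => ?_) fun _ _ _ => rfl⟩
  · have hne := hS.ne_zero x t hp
    rw [← h.sqDiv_dt_eq (hs hp) hne]
    field_simp
    ring
  · have hne := hS.ne_zero x t hp
    simp only [sqDiv₁]
    field_simp
    ring
  · have hne := hS.ne_zero x t hp
    rw [← h.sqDiv_dt_eq (hs hp) hne]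
    field_simp
    ring

lemma dressed_isKdVES (h : DarbouxInput Ω lam u φ μ₀ f g C s) :
    IsKdVES (darbouxDomain Ω (g μ₀) (darbouxT C f g μ₀)) (Fin.snoc (α := fun _ => 𝕜) lam μ₀)
      (dressedU u (g μ₀) (wr (g μ₀) (darbouxT C f g μ₀)))
      (dressedPhi lam φ μ₀ f (g μ₀) (wr (g μ₀) (darbouxT C f g μ₀)) s) := by
  have hS := h.isSeed
  have hs : darbouxDomain Ω (g μ₀) (darbouxT C f g μ₀) ⊆ Ω := fun _ hp => hp.1
  have hφ' := h.dressedPhi_isSchr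
  obtain ⟨E, hE⟩ := h.sqDiv_hasMixed
  have hut : HasDt (darbouxDomain Ω (g μ₀) (darbouxT C f g μ₀))
      (dressedU u (g μ₀) (wr (g μ₀) (darbouxT C f g μ₀))) fun x t => dt u x t - 2 * E x t :=
    fun x t hp => (h.kdves.u_tdiff.hasDt x t (hs hp)).sub ((hE.xt x t hp).const_mul 2)
  refine ⟨hS.dressedU_xdiff, hut.tdiff, fun j => (hφ' j).xdiff, ?_, fun j p hp => ?_⟩
  · rintro ⟨x, t⟩ hp
    set W := wr (g μ₀) (darbouxT C f g μ₀)
    have hsum {m : ℕ} {Ω' : Set (ℝ × ℝ)} {χ : Fin m → ℝ → ℝ → 𝕜} (hp : (x, t) ∈ Ω')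
        (hχ : ∀ j, HasDx Ω' (χ j) (dx (χ j))) :
        HasDerivAt (fun y => ∑ j, χ j y t ^ 2) (dx (fun x t => ∑ j, χ j x t ^ 2) x t) x :=
      DifferentiableAt.hasDerivAt (DifferentiableAt.fun_sum fun j _ =>
        (hχ j x t hp).differentiableAt.pow 2)
    have h₁ := hsum hp fun j => (hφ' j).d₁
    have h₂ := hsum (hs hp) fun j => (h.kdves.isSchr j).d₁
    have hu := h.kdves.u_xdiff.hasDx x t (hs hp)
    have hy := hS.sqDiv₁_hasDx x t hp
    -- `ũ_t = u_t - 2 ((g ^ 2 / W)_x)_t = u_t - 2 ((g ^ 2 / W)_t)_x`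
    have hE' := (hE.tx x t hp).unique (((((hu.const_mul (-6)).mul hy).add
      ((hy.pow 2).const_mul 6)).sub (hS.sqDiv₃_hasDx x t hp)).add (h₁.sub h₂))
    push_cast at hE'
    rw [hut.dt_eq hp, hE', hS.dressedU_hasDx.dx_eq hp, hS.dressedU_hasDx₃.dx_eq hp,
      h.kdves.evolution (x, t) (hs hp)]
    simp only [dressedU]
    ring
  · rw [HasDx.dx_eq (hφ' j).d₂ hp]
    ring

end DarbouxInput

end KdVES

namespace KdVES

variable {𝕜 : Type*} [RCLike 𝕜] {n : ℕ} {Ω : Set (ℝ × ℝ)} {lam : Fin n → 𝕜}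
  {u : ℝ → ℝ → 𝕜} {φ : Fin n → ℝ → ℝ → 𝕜} {μ₀ μ : 𝕜} {f : ℝ → ℝ → 𝕜}
  {g : 𝕜 → ℝ → ℝ → 𝕜} {C s : ℝ → 𝕜} {ψ ψx ψt ψxt : ℝ → ℝ → 𝕜}

/-! ### The transformed Lax pair -/

/-- Equality of the mixed derivatives supplies all the `t`-regularity that the Lax pair asks for. -/
lemma HasMixed.isLax (h : HasMixed Ω ψ ψx ψt ψxt) (hΩ : LineOpen Ω) (hψ : IsSchr Ω u μ ψ)
    (he : ∀ x t, (x, t) ∈ Ω → ψt x t = dx u x t * ψ x t + (4 * μ - 2 * u x t) * dx ψ x t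
      + ∑ j, 1 / (μ - lam j) * (φ j x t * (dx (φ j) x t * ψ x t - φ j x t * dx ψ x t))) :
    IsLax Ω lam u φ μ ψ where
  xdiff := hψ.xdiff
  tdiff := h.t.tdiff
  tdiff_dx := h.xt.tdiff.congr hΩ fun _ _ hp => h.x.dx_eq hp
  xdiff_dt := h.tx.xdiff_one.congr hΩ fun _ _ hp => h.t.dt_eq hp
  mixed p hp := by
    rw [dt_congr hΩ (fun _ _ hp => h.x.dx_eq hp) p.1 p.2 hp,
      dx_congr hΩ (fun _ _ hp => h.t.dt_eq hp) p.1 p.2 hp, h.xt.dt_eq hp, h.tx.dx_eq hp]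
  schrodinger p hp := by
    rw [HasDx.dx_eq hψ.d₂ hp]
    ring
  evolution p hp := by
    rw [h.t.dt_eq hp]
    exact he p.1 p.2 hp

namespace DarbouxInput

/-- The evolution equation of the transformed wave function as an identity at one point. The left
side is its `t`-derivative by the product rule when `W = W(g, T)`; on the right, the sum over `j`
and the summand after it are the source terms of the transformed Lax pair. It splits into an identity
for each source and one without sources. -/
lemma dressed_dt_eq (h : DarbouxInput Ω lam u φ μ₀ f g C s) (hψ : IsLax Ω lam u φ μ ψ)
    (hμ : ∀ j, μ ≠ lam j) (hμ₀ : μ ≠ μ₀) {W : ℝ → ℝ → 𝕜} {x t : ℝ} (hp : (x, t) ∈ Ω)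
    (hW : W x t ≠ 0) :
    (μ₀ - μ) * dt ψ x t + (dt (g μ₀) x t * wr (g μ₀) ψ x t
        + g μ₀ x t * ((μ₀ - μ) * flux lam u φ μ₀ μ (g μ₀) ψ x t)) / W x t
      + g μ₀ x t * wr (g μ₀) ψ x t * (deriv C t * wr f (g μ₀) x t
        + flux lam u φ μ₀ μ₀ (g μ₀) (g μ₀) x t) / W x t ^ 2
      = (dx u x t - 2 * sqDiv₂ u μ₀ (g μ₀) W x t) * dressed (g μ₀) W (μ₀ - μ) ψ x t
        + (4 * μ - 2 * dressedU u (g μ₀) W x t) * dressed₁ (g μ₀) W (μ₀ - μ) ψ x t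
        + (∑ j, 1 / (μ - lam j) *
            ((1 / (lam j - μ₀) * dressed (g μ₀) W (μ₀ - lam j) (φ j) x t) *
              ((1 / (lam j - μ₀) * dressed₁ (g μ₀) W (μ₀ - lam j) (φ j) x t)
                * dressed (g μ₀) W (μ₀ - μ) ψ x t
              - (1 / (lam j - μ₀) * dressed (g μ₀) W (μ₀ - lam j) (φ j) x t)
                * dressed₁ (g μ₀) W (μ₀ - μ) ψ x t))
          + 1 / (μ - μ₀) * ((s t * dressed (g μ₀) W (μ₀ - μ₀) f x t) *
              ((s t * dressed₁ (g μ₀) W (μ₀ - μ₀) f x t) * dressed (g μ₀) W (μ₀ - μ) ψ x t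
              - (s t * dressed (g μ₀) W (μ₀ - μ₀) f x t)
                * dressed₁ (g μ₀) W (μ₀ - μ) ψ x t))) := by
  have hlast : 1 / (μ - μ₀) * ((s t * dressed (g μ₀) W (μ₀ - μ₀) f x t) *
      ((s t * dressed₁ (g μ₀) W (μ₀ - μ₀) f x t) * dressed (g μ₀) W (μ₀ - μ) ψ x t
      - (s t * dressed (g μ₀) W (μ₀ - μ₀) f x t) * dressed₁ (g μ₀) W (μ₀ - μ) ψ x t))
      = g μ₀ x t * wr (g μ₀) ψ x t * (deriv C t * wr f (g μ₀) x t) / W x t ^ 2 := by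
    have hne := sub_ne_zero.2 hμ₀
    rw [← h.s_sq_mul hp]
    simp only [dressed, dressed₁, wr]
    field_simp
    ring
  have hsum : (∑ j, 1 / (μ - lam j) *
        ((1 / (lam j - μ₀) * dressed (g μ₀) W (μ₀ - lam j) (φ j) x t) *
          ((1 / (lam j - μ₀) * dressed₁ (g μ₀) W (μ₀ - lam j) (φ j) x t)
            * dressed (g μ₀) W (μ₀ - μ) ψ x t
          - (1 / (lam j - μ₀) * dressed (g μ₀) W (μ₀ - lam j) (φ j) x t)
            * dressed₁ (g μ₀) W (μ₀ - μ) ψ x t)))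
      = (μ₀ - μ) * (∑ j, 1 / (μ - lam j) * (φ j x t * wr ψ (φ j) x t))
        + wr (g μ₀) ψ x t / W x t *
          (∑ j, 1 / (μ₀ - lam j) * (φ j x t * wr (g μ₀) (φ j) x t))
        + g μ₀ x t * (μ₀ - μ) / W x t * (∑ j, 1 / ((μ₀ - lam j) * (μ - lam j)) *
          (wr (g μ₀) (φ j) x t * wr ψ (φ j) x t))
        + g μ₀ x t * wr (g μ₀) ψ x t / W x t ^ 2 *
          ∑ j, 1 / ((μ₀ - lam j) * (μ₀ - lam j)) *
            (wr (g μ₀) (φ j) x t * wr (g μ₀) (φ j) x t) := by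
    simp only [Finset.mul_sum, ← Finset.sum_add_distrib]
    refine Finset.sum_congr rfl fun j _ => ?_
    have hj := sub_ne_zero.2 (h.ne_lam j)
    have hj₁ := sub_ne_zero.2 (hμ j)
    have hj' : 1 / (lam j - μ₀) = -(1 / (μ₀ - lam j)) := by
      rw [← neg_sub μ₀, one_div_neg_eq_neg_one_div]
    -- the Wronskian of two transformed wave functions
    have hwr : dressed₁ (g μ₀) W (μ₀ - lam j) (φ j) x t * dressed (g μ₀) W (μ₀ - μ) ψ x t
        - dressed (g μ₀) W (μ₀ - lam j) (φ j) x t * dressed₁ (g μ₀) W (μ₀ - μ) ψ x t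
        = (μ₀ - μ) * (μ₀ - lam j) * wr ψ (φ j) x t
          + (μ - lam j) * wr (g μ₀) ψ x t * wr (g μ₀) (φ j) x t / W x t := by
      simp only [dressed, dressed₁, wr]
      field_simp
      ring
    calc _ = 1 / (μ - lam j) * (1 / (μ₀ - lam j)) ^ 2 *
          dressed (g μ₀) W (μ₀ - lam j) (φ j) x t *
          (dressed₁ (g μ₀) W (μ₀ - lam j) (φ j) x t * dressed (g μ₀) W (μ₀ - μ) ψ x t
          - dressed (g μ₀) W (μ₀ - lam j) (φ j) x t
            * dressed₁ (g μ₀) W (μ₀ - μ) ψ x t) := by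
          rw [hj']
          ring
      _ = _ := by
          rw [hwr, dressed]
          field_simp
          ring
  rw [hlast, hsum, h.lax_g₀.dt_eq hp, hψ.dt_eq hp]
  simp only [flux]
  generalize (∑ j, 1 / (μ - lam j) * (φ j x t * wr ψ (φ j) x t)) = S₁
  generalize (∑ j, 1 / (μ₀ - lam j) * (φ j x t * wr (g μ₀) (φ j) x t)) = S₂
  generalize (∑ j, 1 / ((μ₀ - lam j) * (μ - lam j)) *
    (wr (g μ₀) (φ j) x t * wr ψ (φ j) x t)) = S₃
  generalize (∑ j, 1 / ((μ₀ - lam j) * (μ₀ - lam j)) *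
    (wr (g μ₀) (φ j) x t * wr (g μ₀) (φ j) x t)) = S₄
  simp only [dressed, dressed₁, dressedU, sqDiv₁, sqDiv₂, wr]
  field_simp
  ring

lemma dressed_isLax (h : DarbouxInput Ω lam u φ μ₀ f g C s) (hψ : IsLax Ω lam u φ μ ψ)
    (hμ : ∀ j, μ ≠ lam j) (hμ₀ : μ ≠ μ₀) :
    IsLax (darbouxDomain Ω (g μ₀) (darbouxT C f g μ₀)) (Fin.snoc (α := fun _ => 𝕜) lam μ₀)
      (dressedU u (g μ₀) (wr (g μ₀) (darbouxT C f g μ₀)))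
      (dressedPhi lam φ μ₀ f (g μ₀) (wr (g μ₀) (darbouxT C f g μ₀)) s) μ
      (dressed (g μ₀) (wr (g μ₀) (darbouxT C f g μ₀)) (μ₀ - μ) ψ) := by
  have hS := h.isSeed
  have hs : darbouxDomain Ω (g μ₀) (darbouxT C f g μ₀) ⊆ Ω := fun _ hp => hp.1
  have hm := ((hψ.hasMixed.const_mul (μ₀ - μ)).mono hs).add
    (((h.lax_g₀.hasMixed.mul
      (wr_hasMixed h.lineOpen h.kdves h.lax_g₀ hψ h.ne_lam hμ)).mono hs).mul
      ((h.wr_darbouxT_hasMixed.mono hs).inv hS.ne_zero))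
  have he : (fun x t => (μ₀ - μ) * ψ x t + g μ₀ x t * wr (g μ₀) ψ x t *
      (wr (g μ₀) (darbouxT C f g μ₀) x t)⁻¹)
      = dressed (g μ₀) (wr (g μ₀) (darbouxT C f g μ₀)) (μ₀ - μ) ψ := by
    funext x t
    rw [dressed, div_eq_mul_inv]
  rw [he] at hm
  refine hm.isLax hS.lineOpen (hS.dressed_isSchr (hψ.isSchr.mono hs)) fun x t hp => ?_
  have hd := hS.dressed_hasDx (hψ.isSchr.mono hs)
  rw [hS.dressedU_hasDx.dx_eq hp, hd.dx_eq hp, Fin.sum_univ_castSucc]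
  have hj : ∀ j, dx (fun x t => 1 / (lam j - μ₀) *
      dressed (g μ₀) (wr (g μ₀) (darbouxT C f g μ₀)) (μ₀ - lam j) (φ j) x t) x t
      = 1 / (lam j - μ₀) *
        dressed₁ (g μ₀) (wr (g μ₀) (darbouxT C f g μ₀)) (μ₀ - lam j) (φ j) x t := fun j =>
    ((hS.dressed_hasDx ((h.kdves.isSchr j).mono hs) x t hp).const_mul _).deriv
  have hl : dx (fun x t => s t *
      dressed (g μ₀) (wr (g μ₀) (darbouxT C f g μ₀)) (μ₀ - μ₀) f x t) x t
      = s t * dressed₁ (g μ₀) (wr (g μ₀) (darbouxT C f g μ₀)) (μ₀ - μ₀) f x t :=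
    ((hS.dressed_hasDx (h.lax_f.isSchr.mono hs) x t hp).const_mul _).deriv
  simp only [dressedPhi_castSucc, dressedPhi_last, Fin.snoc_castSucc, Fin.snoc_last, hj, hl]
  rw [← h.dressed_dt_eq hψ hμ hμ₀ (hs hp) (hS.ne_zero x t hp)]
  ring

/-- The transformed functions solve the equation with one more source. -/
lemma darboux_isKdVES (h : DarbouxInput Ω lam u φ μ₀ f g C s) :
    IsKdVES (darbouxDomain Ω (g μ₀) (darbouxT C f g μ₀)) (Fin.snoc (α := fun _ => 𝕜) lam μ₀)
      (darbouxU u (g μ₀) (darbouxT C f g μ₀))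
      (darbouxPhi lam φ μ₀ f (g μ₀) (darbouxT C f g μ₀) s) :=
  h.dressed_isKdVES.congr h.lineOpen_domain (fun _ _ hp => h.darbouxU_eq hp)
    fun j _ _ hp => h.darbouxPhi_eq j hp

/-- The transformed wave functions solve the Lax pair with one more source. -/
lemma darboux_isLax (h : DarbouxInput Ω lam u φ μ₀ f g C s) (hψ : IsLax Ω lam u φ μ ψ)
    (hμ : ∀ j, μ ≠ lam j) (hμ₀ : μ ≠ μ₀) :
    IsLax (darbouxDomain Ω (g μ₀) (darbouxT C f g μ₀)) (Fin.snoc (α := fun _ => 𝕜) lam μ₀)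
      (darbouxU u (g μ₀) (darbouxT C f g μ₀))
      (darbouxPhi lam φ μ₀ f (g μ₀) (darbouxT C f g μ₀) s) μ
      (darbouxPsi (g μ₀) (darbouxT C f g μ₀) ψ) :=
  (h.dressed_isLax hψ hμ hμ₀).congr h.lineOpen_domain (fun _ _ hp => h.darbouxU_eq hp)
    (fun j _ _ hp => h.darbouxPhi_eq j hp) fun _ _ hp => h.darbouxPsi_eq hψ.isSchr hp

end DarbouxInput

end KdVES

namespace KdVES

/-! ### The common form of the positon and the negaton -/

/-- The phase of the positon (`σ = 1`) and of the negaton (`σ = -1`). -/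
def wavePhase (σ : ℝ) (η b : ℝ → ℝ) (k x t : ℝ) : ℝ :=
  k * x + σ * (4 * k ^ 3 * t - η t / k) + b k

/-- The pair `(sin, cos)` for `σ = 1`, and `(sinh, cosh)` for `σ = -1`, through the properties that
matter. -/
structure IsWavePair (σ : ℝ) (S c : ℝ → ℝ) : Prop where
  sign : σ * σ = 1
  deriv_S : ∀ z, HasDerivAt S (c z) z
  deriv_c : ∀ z, HasDerivAt c (-σ * S z) z
  pyth : ∀ z, c z ^ 2 + σ * S z ^ 2 = 1

lemma isWavePair_trig : IsWavePair 1 Real.sin Real.cos where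
  sign := one_mul 1
  deriv_S := Real.hasDerivAt_sin
  deriv_c z := (Real.hasDerivAt_cos z).congr_deriv (by ring)
  pyth z := by linear_combination Real.sin_sq_add_cos_sq z

lemma isWavePair_hyperbolic : IsWavePair (-1) Real.sinh Real.cosh where
  sign := by norm_num
  deriv_S := Real.hasDerivAt_sinh
  deriv_c z := (Real.hasDerivAt_cosh z).congr_deriv (by ring)
  pyth z := by linear_combination Real.cosh_sq_sub_sinh_sq z

variable {σ k : ℝ} {η b C S c : ℝ → ℝ}

lemma wavePhase_hasDx : HasDx Set.univ (wavePhase σ η b k) fun _ _ => k := by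
  intro x t _
  refine ((((hasDerivAt_id x).const_mul k).add_const _).add_const _).congr_deriv (mul_one k)

lemma wavePhase_hasDt (hη : Differentiable ℝ η) :
    HasDt Set.univ (wavePhase σ η b k) fun _ t => σ * (4 * k ^ 3 - deriv η t / k) := by
  intro x t _
  refine ((((((hasDerivAt_id t).const_mul (4 * k ^ 3)).sub
    ((hη t).hasDerivAt.div_const k)).const_mul σ).const_add (k * x)).add_const _).congr_deriv
    (by ring)

lemma lineOpen_univ : LineOpen (Set.univ : Set (ℝ × ℝ)) := isOpen_univ.lineOpen

/-- A function of the phase has both mixed second derivatives. -/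
lemma hasMixed_comp_wavePhase (hη : Differentiable ℝ η) {A A' A'' : ℝ → ℝ}
    (hA : ∀ z, HasDerivAt A (A' z) z) (hA' : ∀ z, HasDerivAt A' (A'' z) z) :
    HasMixed Set.univ (fun x t => A (wavePhase σ η b k x t))
      (fun x t => k * A' (wavePhase σ η b k x t))
      (fun x t => σ * (4 * k ^ 3 - deriv η t / k) * A' (wavePhase σ η b k x t))
      (fun x t => k * (σ * (4 * k ^ 3 - deriv η t / k)) * A'' (wavePhase σ η b k x t)) where
  x x t hp := ((hA _).comp x (wavePhase_hasDx x t hp)).congr_deriv (by ring)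
  t x t hp := ((hA _).comp t (wavePhase_hasDt hη x t hp)).congr_deriv (by ring)
  xt x t hp := (((hA' _).comp t (wavePhase_hasDt hη x t hp)).const_mul k).congr_deriv (by ring)
  tx x t hp := (((hA' _).comp x (wavePhase_hasDx x t hp)).const_mul
    (σ * (4 * k ^ 3 - deriv η t / k))).congr_deriv (by ring)

/-- A function `A` of the phase with `A'' = -σ A` solves the Lax pair of the solution `u = 0`,
`φ₁ = √η_t` for the spectral value `σ k ^ 2`. -/
lemma isLax_comp_wavePhase (hσ : σ * σ = 1) (hk : 0 < k) (hη : Differentiable ℝ η)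
    (hη' : ∀ t, 0 ≤ deriv η t) {A A' : ℝ → ℝ} (hA : ∀ z, HasDerivAt A (A' z) z)
    (hA' : ∀ z, HasDerivAt A' (-σ * A z) z) :
    IsLax Set.univ ![(0 : ℝ)] (fun _ _ => 0) ![fun _ t => √(deriv η t)] (σ * k ^ 2)
      (fun x t => A (wavePhase σ η b k x t)) := by
  have hm := hasMixed_comp_wavePhase (σ := σ) (b := b) (k := k) hη hA hA'
  have hd : dx (fun x t => A (wavePhase σ η b k x t))
      = fun x t => k * A' (wavePhase σ η b k x t) := by
    funext x t
    exact hm.x.dx_eq (Set.mem_univ _)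
  refine hm.isLax lineOpen_univ ⟨?_, ?_⟩ fun x t _ => ?_
  · rw [hd]
    exact hm.x
  · rw [hd]
    intro x t hp
    exact (((hA' _).comp x (wavePhase_hasDx x t hp)).const_mul k).congr_deriv (by ring)
  · have hσ' : σ ≠ 0 := left_ne_zero_of_mul_eq_one hσ
    have hs : √(deriv η t) * √(deriv η t) = deriv η t := Real.mul_self_sqrt (hη' t)
    simp only [hd, Fin.sum_univ_one, Matrix.cons_val_fin_one]
    simp only [dx, deriv_const]
    field_simp
    linear_combination -k ^ 2 * A' (wavePhase σ η b k x t) * deriv η t * hσ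
      + k ^ 2 * A' (wavePhase σ η b k x t) * hs

lemma isKdVES_zero :
    IsKdVES Set.univ ![(0 : ℝ)] (fun _ _ => 0) ![fun _ t => √(deriv η t)] := by
  have hx (F : ℝ → ℝ) : HasDx Set.univ (fun _ t => F t) fun _ _ => 0 :=
    fun x t _ => hasDerivAt_const x (F t)
  have hd (F : ℝ → ℝ) : dx (fun _ t => F t) = fun _ _ => 0 := by
    funext x t
    exact (hx F).dx_eq (Set.mem_univ _)
  have h₁ (F : ℝ → ℝ) : XDiff 1 Set.univ fun _ t => F t := (hx F).xdiff_one
  have h₂ (F : ℝ → ℝ) : XDiff 2 Set.univ fun _ t => F t :=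
    (hx F).xdiff_succ lineOpen_univ (h₁ fun _ => 0)
  refine ⟨(hx fun _ => 0).xdiff_succ lineOpen_univ (h₂ fun _ => 0),
    fun p _ => differentiableAt_const _, fun j => ?_, fun p _ => ?_, fun j p _ => ?_⟩
  · obtain rfl := Fin.fin_one_eq_zero j
    exact h₂ _
  · simp [dx, dt]
  · obtain rfl := Fin.fin_one_eq_zero j
    simp [dx]

/-- The derivative of the phase in the spectral value `σ k ^ 2`. -/
def wavePhaseLam (σ : ℝ) (η b : ℝ → ℝ) (k x t : ℝ) : ℝ :=
  σ / (2 * k) * (x + σ * (12 * k ^ 2 * t + η t / k ^ 2) + deriv b k)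

lemma wavePhase_hasDerivAt (hk : 0 < k) (hb : DifferentiableAt ℝ b k) (x t : ℝ) :
    HasDerivAt (fun κ => wavePhase σ η b κ x t)
      (x + σ * (12 * k ^ 2 * t + η t / k ^ 2) + deriv b k) k := by
  have hk' := hk.ne'
  refine ((((hasDerivAt_id k).mul_const x).add ((((((hasDerivAt_id k).pow 3).const_mul 4).mul_const
    t).sub ((hasDerivAt_const k (η t)).div (hasDerivAt_id k) hk')).const_mul σ)).add
    hb.hasDerivAt).congr_deriv ?_
  simp only [id]
  field_simp
  push_cast
  ring

lemma sqrt_sign_mul (hσ : σ * σ = 1) (hk : 0 < k) : √(σ * (σ * k ^ 2)) = k := by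
  rw [← mul_assoc, hσ, one_mul, Real.sqrt_sq hk.le]

lemma sqrt_hasDerivAt (hσ : σ * σ = 1) (hk : 0 < k) :
    HasDerivAt (fun μ => √(σ * μ)) (σ / (2 * k)) (σ * k ^ 2) := by
  have h₁ : σ * (σ * k ^ 2) ≠ 0 := by
    rw [← mul_assoc, hσ, one_mul]
    positivity
  refine (((hasDerivAt_id (σ * k ^ 2)).const_mul σ).sqrt h₁).congr_deriv ?_
  simp only [id]
  rw [sqrt_sign_mul hσ hk, mul_one]

lemma wavePhase_sqrt_hasDerivAt (hσ : σ * σ = 1) (hk : 0 < k) (hb : DifferentiableAt ℝ b k)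
    (x t : ℝ) : HasDerivAt (fun μ => wavePhase σ η b (√(σ * μ)) x t)
      (wavePhaseLam σ η b k x t) (σ * k ^ 2) := by
  have h := wavePhase_hasDerivAt (σ := σ) (η := η) hk hb x t
  rw [← sqrt_sign_mul hσ hk] at h
  refine (h.comp (σ * k ^ 2) (sqrt_hasDerivAt hσ hk)).congr_deriv ?_
  rw [sqrt_sign_mul hσ hk, wavePhaseLam]
  ring

lemma wavePhaseLam_hasDx :
    HasDx Set.univ (wavePhaseLam σ η b k) fun _ _ => σ / (2 * k) := by
  intro x t _
  exact ((((hasDerivAt_id x).add_const _).add_const _).const_mul _).congr_deriv (mul_one _)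

lemma wavePhaseLam_hasDt (hη : Differentiable ℝ η) : HasDt Set.univ (wavePhaseLam σ η b k)
    fun _ t => σ / (2 * k) * (σ * (12 * k ^ 2 + deriv η t / k ^ 2)) := by
  intro x t _
  exact (((((((hasDerivAt_id t).const_mul (12 * k ^ 2)).add
    ((hη t).hasDerivAt.div_const (k ^ 2))).const_mul σ).const_add x).add_const _).const_mul
    _).congr_deriv (by ring)

/-- The family of solutions of the Lax pair behind the positon and the negaton. -/
def waveFamily (σ : ℝ) (η b S : ℝ → ℝ) (μ x t : ℝ) : ℝ := S (wavePhase σ η b (√(σ * μ)) x t)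

namespace IsWavePair

variable (h : IsWavePair σ S c)
include h

lemma waveFamily_eq (hk : 0 < k) :
    waveFamily σ η b S (σ * k ^ 2) = fun x t => S (wavePhase σ η b k x t) := by
  funext x t
  rw [waveFamily, sqrt_sign_mul h.sign hk]

lemma dx_c : dx (fun x t => c (wavePhase σ η b k x t))
    = fun x t => -σ * k * S (wavePhase σ η b k x t) := by
  funext x t
  exact (((h.deriv_c _).comp x (wavePhase_hasDx x t trivial)).congr_deriv (by ring)).deriv

lemma dx_S : dx (fun x t => S (wavePhase σ η b k x t))
    = fun x t => k * c (wavePhase σ η b k x t) := by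
  funext x t
  exact (((h.deriv_S _).comp x (wavePhase_hasDx x t trivial)).congr_deriv (by ring)).deriv

lemma dlam_waveFamily (hk : 0 < k) (hb : DifferentiableAt ℝ b k) :
    dlam (waveFamily σ η b S) (σ * k ^ 2)
      = fun x t => c (wavePhase σ η b k x t) * wavePhaseLam σ η b k x t := by
  funext x t
  have h₁ := (h.deriv_S _).comp (σ * k ^ 2)
    (wavePhase_sqrt_hasDerivAt (η := η) h.sign hk hb x t)
  rw [sqrt_sign_mul h.sign hk] at h₁
  exact h₁.deriv

lemma lamRegular (hk : 0 < k) (hη : Differentiable ℝ η) (hb : DifferentiableAt ℝ b k) :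
    LamRegular Set.univ (waveFamily σ η b S) (σ * k ^ 2) := by
  have hσ := h.sign
  have hk' := hk.ne'
  have hΘx := wavePhase_hasDx (σ := σ) (η := η) (b := b) (k := k)
  have hΘt := wavePhase_hasDt (σ := σ) (b := b) (k := k) hη
  have hPx := wavePhaseLam_hasDx (σ := σ) (η := η) (b := b) (k := k)
  have hPt := wavePhaseLam_hasDt (σ := σ) (b := b) (k := k) hη
  -- the derivatives of `∂_λ g` in `x` and `t`
  have h₁ : HasDx Set.univ (dlam (waveFamily σ η b S) (σ * k ^ 2)) fun x t =>
      -σ * k * S (wavePhase σ η b k x t) * wavePhaseLam σ η b k x t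
        + c (wavePhase σ η b k x t) * (σ / (2 * k)) := by
    rw [h.dlam_waveFamily hk hb]
    exact fun x t hp => (((h.deriv_c _).comp x (hΘx x t hp)).mul (hPx x t hp)).congr_deriv
      (by simp only [Function.comp_apply]; ring)
  have h₁' : dx (dlam (waveFamily σ η b S) (σ * k ^ 2)) = _ :=
    funext₂ fun x t => h₁.dx_eq (Set.mem_univ (x, t))
  have h₂ : HasDx Set.univ (dx (dlam (waveFamily σ η b S) (σ * k ^ 2))) fun x t =>
      -S (wavePhase σ η b k x t)
        - σ * k ^ 2 * c (wavePhase σ η b k x t) * wavePhaseLam σ η b k x t := by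
    rw [h₁']
    intro x t hp
    refine (((((h.deriv_S _).comp x (hΘx x t hp)).const_mul (-σ * k)).mul (hPx x t hp)).add
      (((h.deriv_c _).comp x (hΘx x t hp)).mul_const (σ / (2 * k)))).congr_deriv ?_
    simp only [Function.comp_apply]
    field_simp
    linear_combination -2 * S (wavePhase σ η b k x t) * hσ
  have h₃ : HasDt Set.univ (dlam (waveFamily σ η b S) (σ * k ^ 2)) fun x t =>
      σ * (4 * k ^ 3 - deriv η t / k) * (-σ * S (wavePhase σ η b k x t))
          * wavePhaseLam σ η b k x t
        + c (wavePhase σ η b k x t)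
          * (σ / (2 * k) * (σ * (12 * k ^ 2 + deriv η t / k ^ 2))) := by
    rw [h.dlam_waveFamily hk hb]
    exact fun x t hp => (((h.deriv_c _).comp t (hΘt x t hp)).mul (hPt x t hp)).congr_deriv
      (by simp only [Function.comp_apply]; ring)
  have h₄ : HasDt Set.univ (dx (dlam (waveFamily σ η b S) (σ * k ^ 2))) fun x t =>
      -σ * k * (σ * (4 * k ^ 3 - deriv η t / k) * c (wavePhase σ η b k x t)
          * wavePhaseLam σ η b k x t
        + S (wavePhase σ η b k x t) * (σ / (2 * k) * (σ * (12 * k ^ 2 + deriv η t / k ^ 2))))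
      + σ * (4 * k ^ 3 - deriv η t / k) * (-σ * S (wavePhase σ η b k x t)) * (σ / (2 * k)) := by
    rw [h₁']
    exact fun x t hp => (((((h.deriv_S _).comp t (hΘt x t hp)).const_mul (-σ * k)).mul
      (hPt x t hp)).add (((h.deriv_c _).comp t (hΘt x t hp)).mul_const
        (σ / (2 * k)))).congr_deriv (by simp only [Function.comp_apply]; ring)
  -- the derivatives of `g` in `x` and `t`, for all spectral values
  -- (where `√(σ μ) = 0` they hold with `x / 0 = 0`)
  have hm (μ : ℝ) : HasMixed Set.univ (waveFamily σ η b S μ) _ _ _ :=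
    hasMixed_comp_wavePhase (σ := σ) (b := b) (k := √(σ * μ)) hη h.deriv_S h.deriv_c
  have hgx (x t μ : ℝ) := (hm μ).x.dx_eq (Set.mem_univ (x, t))
  have hgt (x t μ : ℝ) := (hm μ).t.dt_eq (Set.mem_univ (x, t))
  have hgxt (x t μ : ℝ) : dt (dx (waveFamily σ η b S μ)) x t
      = √(σ * μ) * (σ * (4 * √(σ * μ) ^ 3 - deriv η t / √(σ * μ)))
        * (-σ * S (wavePhase σ η b (√(σ * μ)) x t)) := by
    rw [dt_congr lineOpen_univ (fun x t hp => (hm μ).x.dx_eq hp) x t trivial,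
      (hm μ).xt.dt_eq (Set.mem_univ (x, t))]
  have hgxx (x t μ : ℝ) : dx (dx (waveFamily σ η b S μ)) x t
      = √(σ * μ) * (√(σ * μ) * (-σ * S (wavePhase σ η b (√(σ * μ)) x t))) := by
    rw [dx_congr lineOpen_univ (fun x t hp => (hm μ).x.dx_eq hp) x t trivial]
    exact ((((h.deriv_c _).comp x (wavePhase_hasDx x t trivial)).const_mul _).congr_deriv
      (by ring)).deriv
  -- their derivatives in the spectral value
  have hκ := sqrt_hasDerivAt hσ hk
  have hκ₀ := sqrt_sign_mul hσ hk
  have hS (x t : ℝ) := (h.deriv_S _).comp (σ * k ^ 2)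
    (wavePhase_sqrt_hasDerivAt (η := η) hσ hk hb x t)
  have hc (x t : ℝ) := (h.deriv_c _).comp (σ * k ^ 2)
    (wavePhase_sqrt_hasDerivAt (η := η) hσ hk hb x t)
  have hp (t : ℝ) : HasDerivAt (fun μ => σ * (4 * √(σ * μ) ^ 3 - deriv η t / √(σ * μ)))
      (σ / (2 * k) * (σ * (12 * k ^ 2 + deriv η t / k ^ 2))) (σ * k ^ 2) := by
    refine ((((hκ.pow 3).const_mul 4).sub ((hasDerivAt_const _ (deriv η t)).div hκ
      (by rw [hκ₀]; exact hk'))).const_mul σ).congr_deriv ?_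
    rw [hκ₀]
    push_cast
    field_simp
    ring
  refine ⟨?_, h₃.tdiff, h₄.tdiff, fun p _ => ?_, fun p _ => ?_, fun p _ => ?_, fun p _ => ?_,
    fun p _ => ?_⟩
  · exact (xdiff_succ_iff 1).2 ⟨h₁.xdiff_one, h₂.xdiff_one⟩
  · exact (hS p.1 p.2).differentiableAt.hasDerivAt
  · rw [h₁.dx_eq (Set.mem_univ p)]
    simp only [hgx]
    refine (hκ.mul (hc p.1 p.2)).congr_deriv ?_
    simp only [Function.comp_apply, hκ₀]
    ring
  · rw [h₂.dx_eq (Set.mem_univ p)]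
    simp only [hgxx]
    refine (hκ.mul (hκ.mul ((hS p.1 p.2).const_mul (-σ)))).congr_deriv ?_
    simp only [Function.comp_apply, hκ₀, Pi.mul_apply]
    field_simp
    linear_combination -2 * S (wavePhase σ η b k p.1 p.2) * hσ
  · rw [h₃.dt_eq (Set.mem_univ p)]
    simp only [hgt]
    refine ((hp p.2).mul (hc p.1 p.2)).congr_deriv ?_
    simp only [Function.comp_apply, hκ₀]
    ring
  · rw [h₄.dt_eq (Set.mem_univ p)]
    simp only [hgxt]
    refine ((hκ.mul (hp p.2)).mul ((hS p.1 p.2).const_mul (-σ))).congr_deriv ?_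
    simp only [Function.comp_apply, hκ₀, Pi.mul_apply]
    ring

end IsWavePair

end KdVES

namespace KdVES

/-- The function `γ = C + σ ∂_k Θ / (2 k)`, with which `T = γ c(Θ)`. -/
def waveGamma (σ : ℝ) (η b C : ℝ → ℝ) (k x t : ℝ) : ℝ := C t + wavePhaseLam σ η b k x t

/-- The common denominator `2 k ^ 2 γ - σ S(Θ) c(Θ)`, which is `-2 k W(g, T)`. -/
def waveDenom (σ : ℝ) (η b C S c : ℝ → ℝ) (k x t : ℝ) : ℝ :=
  2 * k ^ 2 * waveGamma σ η b C k x t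
    - σ * (S (wavePhase σ η b k x t) * c (wavePhase σ η b k x t))

namespace IsWavePair

variable {σ k : ℝ} {η b C S c : ℝ → ℝ}

lemma wr_eq (h : IsWavePair σ S c) (hk : 0 < k) (x t : ℝ) :
    wr (fun x t => c (wavePhase σ η b k x t)) (waveFamily σ η b S (σ * k ^ 2)) x t = k := by
  rw [wr, h.waveFamily_eq hk, h.dx_S, h.dx_c]
  linear_combination k * h.pyth (wavePhase σ η b k x t)

lemma darbouxInput (h : IsWavePair σ S c) (hk : 0 < k) (hη : Differentiable ℝ η)
    (hη' : ∀ t, 0 ≤ deriv η t) (hb : DifferentiableAt ℝ b k) (hC : Differentiable ℝ C)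
    (hC' : ∀ t, 0 ≤ deriv C t) :
    DarbouxInput Set.univ ![(0 : ℝ)] (fun _ _ => 0) ![fun _ t => √(deriv η t)] (σ * k ^ 2)
      (fun x t => c (wavePhase σ η b k x t)) (waveFamily σ η b S) C
      fun t => √(deriv C t / k) where
  isOpen := isOpen_univ
  kdves := isKdVES_zero
  ne_lam j := by
    obtain rfl := Fin.fin_one_eq_zero j
    exact mul_ne_zero (left_ne_zero_of_mul_eq_one h.sign) (pow_ne_zero 2 hk.ne')
  lax_f := isLax_comp_wavePhase h.sign hk hη hη' h.deriv_c
    fun z => ((h.deriv_S z).const_mul (-σ))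
  lax_g := by
    have hpos : ∀ᶠ μ in 𝓝 (σ * k ^ 2), 0 < σ * μ := by
      refine (continuous_const.mul continuous_id).continuousAt.eventually (lt_mem_nhds ?_)
      change 0 < σ * (σ * k ^ 2)
      rw [← mul_assoc, h.sign, one_mul]
      positivity
    filter_upwards [hpos] with μ hμ
    have he : μ = σ * √(σ * μ) ^ 2 := by
      rw [Real.sq_sqrt hμ.le, ← mul_assoc, h.sign, one_mul]
    have hl := isLax_comp_wavePhase (b := b) h.sign (Real.sqrt_pos.2 hμ) hη hη' h.deriv_S
      h.deriv_c
    rwa [← he] at hl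
  regular_g := h.lamRegular hk hη hb
  wronskian_ne p _ := by
    rw [wronskian_two]
    exact (h.wr_eq hk p.1 p.2).trans_ne hk.ne'
  C_diff p _ := hC p.2
  s_sq p _ := by
    rw [wronskian_two, Real.sq_sqrt (div_nonneg (hC' _) hk.le)]
    exact congrArg _ (h.wr_eq hk p.1 p.2).symm

lemma darbouxT_eq (h : IsWavePair σ S c) (hk : 0 < k) (hb : DifferentiableAt ℝ b k) :
    darbouxT C (fun x t => c (wavePhase σ η b k x t)) (waveFamily σ η b S) (σ * k ^ 2)
      = fun x t => waveGamma σ η b C k x t * c (wavePhase σ η b k x t) := by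
  funext x t
  rw [darbouxT, h.dlam_waveFamily hk hb, waveGamma]
  ring

lemma wr_darbouxT_eq (h : IsWavePair σ S c) (hk : 0 < k) (hb : DifferentiableAt ℝ b k)
    (x t : ℝ) :
    wr (waveFamily σ η b S (σ * k ^ 2))
      (darbouxT C (fun x t => c (wavePhase σ η b k x t)) (waveFamily σ η b S) (σ * k ^ 2)) x t
      = -waveDenom σ η b C S c k x t / (2 * k) := by
  have h₁ : dx (fun x t => waveGamma σ η b C k x t * c (wavePhase σ η b k x t)) x t
      = σ / (2 * k) * c (wavePhase σ η b k x t)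
        + waveGamma σ η b C k x t * (-σ * S (wavePhase σ η b k x t) * k) :=
    (((wavePhaseLam_hasDx x t trivial).const_add (C t)).mul
      ((h.deriv_c _).comp x (wavePhase_hasDx x t trivial))).deriv
  rw [wr, h.darbouxT_eq hk hb, h₁, h.waveFamily_eq hk, h.dx_S, waveDenom]
  field_simp
  linear_combination -2 * k ^ 2 * waveGamma σ η b C k x t * h.pyth (wavePhase σ η b k x t)

/-- The input and the result of the Darboux transformation of the solution `u = 0`, `φ₁ = √η_t`, for
both signs `σ`. -/
theorem darboux_transform (h : IsWavePair σ S c) (hk : 0 < k) (hη : Differentiable ℝ η)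
    (hη' : ∀ t, 0 ≤ deriv η t) (hb : DifferentiableAt ℝ b k) (hC : Differentiable ℝ C)
    (hC' : ∀ t, 0 ≤ deriv C t) {μ₀ : ℝ} {f : ℝ → ℝ → ℝ} {g : ℝ → ℝ → ℝ → ℝ} {T : ℝ → ℝ → ℝ}
    {Ω : Set (ℝ × ℝ)} {U : ℝ → ℝ → ℝ} {Φ : Fin 2 → ℝ → ℝ → ℝ} (hμ₀ : μ₀ = σ * k ^ 2)
    (hf : f = fun x t => c (wavePhase σ η b k x t)) (hg : g = waveFamily σ η b S)
    (hT : T = darbouxT C f g μ₀) (hΩ : ∀ x t, (x, t) ∈ Ω ↔ waveDenom σ η b C S c k x t ≠ 0)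
    (hU : ∀ x t, (x, t) ∈ Ω → U x t = 8 * k ^ 2
      * (2 * k ^ 2 * waveGamma σ η b C k x t * c (wavePhase σ η b k x t)
        - σ * S (wavePhase σ η b k x t)) * S (wavePhase σ η b k x t)
      / waveDenom σ η b C S c k x t ^ 2)
    (hΦ₀ : ∀ x t, (x, t) ∈ Ω → Φ 0 x t = -√(deriv η t)
      * (2 * k ^ 2 * waveGamma σ η b C k x t
        + σ * (S (wavePhase σ η b k x t) * c (wavePhase σ η b k x t)))
      / waveDenom σ η b C S c k x t)
    (hΦ₁ : ∀ x t, (x, t) ∈ Ω → Φ 1 x t = 2 * k * √(k * deriv C t)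
      * S (wavePhase σ η b k x t) / waveDenom σ η b C S c k x t) :
    DarbouxInput Set.univ ![0] (fun _ _ => 0) ![fun _ t => √(deriv η t)] μ₀ f g C
        (fun t => √(deriv C t / k)) ∧
      darbouxDomain Set.univ (g μ₀) T = Ω ∧
      (∀ p ∈ Ω, darbouxU (fun _ _ => 0) (g μ₀) T p.1 p.2 = U p.1 p.2) ∧
      (∀ p ∈ Ω, ∀ j, darbouxPhi ![0] ![fun _ t => √(deriv η t)] μ₀ f (g μ₀) T
        (fun t => √(deriv C t / k)) j p.1 p.2 = Φ j p.1 p.2) ∧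
      IsKdVES Ω ![0, μ₀] U Φ := by
  have hI := h.darbouxInput (b := b) hk hη hη' hb hC hC'
  have hW := h.wr_darbouxT_eq (η := η) (b := b) (C := C) hk hb
  subst hμ₀ hf hg hT
  have hdom : darbouxDomain Set.univ (waveFamily σ η b S (σ * k ^ 2)) (darbouxT C
      (fun x t => c (wavePhase σ η b k x t)) (waveFamily σ η b S) (σ * k ^ 2)) = Ω := by
    ext ⟨x, t⟩
    have hw : wronskian ![waveFamily σ η b S (σ * k ^ 2), darbouxT C
        (fun x t => c (wavePhase σ η b k x t)) (waveFamily σ η b S) (σ * k ^ 2)] x t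
        = -waveDenom σ η b C S c k x t / (2 * k) := (wronskian_two _ _ x t).trans (hW x t)
    simp [darbouxDomain, hw, hΩ, hk.ne']
  have hσ := h.sign
  have hσ' : σ ≠ 0 := left_ne_zero_of_mul_eq_one hσ
  have hUeq : ∀ p ∈ Ω, darbouxU (fun _ _ => 0) (waveFamily σ η b S (σ * k ^ 2)) (darbouxT C
      (fun x t => c (wavePhase σ η b k x t)) (waveFamily σ η b S) (σ * k ^ 2)) p.1 p.2
      = U p.1 p.2 := by
    rintro ⟨x, t⟩ hp
    have hD := (hΩ x t).1 hp
    rw [hU x t hp, hI.darbouxU_eq (hdom ▸ hp), dressedU, sqDiv₁, hW, h.waveFamily_eq hk, h.dx_S]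
    have hP := h.pyth (wavePhase σ η b k x t)
    field_simp
    rw [waveDenom]
    linear_combination -8 * k ^ 2 * σ * S (wavePhase σ η b k x t) ^ 2 * hP
      + 8 * k ^ 2 * S (wavePhase σ η b k x t) ^ 4 * hσ
  have hΦeq : ∀ p ∈ Ω, ∀ j, darbouxPhi ![0] ![fun _ t => √(deriv η t)] (σ * k ^ 2)
      (fun x t => c (wavePhase σ η b k x t)) (waveFamily σ η b S (σ * k ^ 2)) (darbouxT C
      (fun x t => c (wavePhase σ η b k x t)) (waveFamily σ η b S) (σ * k ^ 2))
      (fun t => √(deriv C t / k)) j p.1 p.2 = Φ j p.1 p.2 := by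
    rintro ⟨x, t⟩ hp j
    have hD := (hΩ x t).1 hp
    rw [hI.darbouxPhi_eq j (hdom ▸ hp)]
    have hw := h.wr_eq (η := η) (b := b) hk x t
    -- the factor `√(C_t / W(f, g)) W(f, g)` with `W(f, g) = k`
    have hsqrt : k * √(deriv C t / k) = √(k * deriv C t) := by
      rw [show k * deriv C t = k ^ 2 * (deriv C t / k) by field_simp,
        Real.sqrt_mul (sq_nonneg k), Real.sqrt_sq hk.le]
    refine Fin.lastCases ?_ (fun j => ?_) j
    · rw [dressedPhi_last, show Fin.last 1 = 1 from rfl, hΦ₁ x t hp]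
      have hw' : wr (waveFamily σ η b S (σ * k ^ 2))
          (fun x t => c (wavePhase σ η b k x t)) x t = -k := by
        rw [wr_swap, hw]
      simp only [dressed, hW, hw', sub_self, zero_mul, zero_add, ← hsqrt]
      rw [h.waveFamily_eq hk]
      field_simp
    · obtain rfl := Fin.fin_one_eq_zero j
      have hd : dx (fun _ t => √(deriv η t)) x t = 0 := deriv_const x _
      rw [dressedPhi_castSucc, Fin.castSucc_zero, hΦ₀ x t hp]
      simp only [dressed, hW, Matrix.cons_val_fin_one]
      simp only [wr, hd]
      rw [h.waveFamily_eq hk, h.dx_S]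
      field_simp
      rw [waveDenom]
      linear_combination (-2 * k ^ 2 * S (wavePhase σ η b k x t) * c (wavePhase σ η b k x t)
        * √(deriv η t)) * hσ
  refine ⟨hI, hdom, hUeq, hΦeq, ?_⟩
  have hΩ' : LineOpen Ω := hdom ▸ hI.lineOpen_domain
  have hK := hI.darboux_isKdVES
  rw [hdom] at hK
  have hlam : (Fin.snoc (α := fun _ => ℝ) ![(0 : ℝ)] (σ * k ^ 2) : Fin 2 → ℝ)
      = ![0, σ * k ^ 2] := by
    funext j
    fin_cases j <;> rfl
  rw [← hlam]
  exact hK.congr hΩ' (fun x t hp => (hUeq (x, t) hp).symm) fun j x t hp =>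
    (hΦeq (x, t) hp j).symm

end IsWavePair

end KdVES

namespace KdVES

/-! ### The positon and the negaton -/

variable {k : ℝ} {η b : ℝ → ℝ}

lemma positonPhase_eq (η b : ℝ → ℝ) (k x t : ℝ) :
    positonPhase η b k x t = wavePhase 1 η b k x t := by
  rw [positonPhase, wavePhase]
  ring

lemma negatonPhase_eq (η b : ℝ → ℝ) (k x t : ℝ) :
    negatonPhase η b k x t = wavePhase (-1) η b k x t := by
  rw [negatonPhase, wavePhase]
  ring

lemma positonGamma_eq (hk : 0 < k) (hb : DifferentiableAt ℝ b k) (C : ℝ → ℝ) (x t : ℝ) :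
    positonGamma η b C k x t = waveGamma 1 η b C k x t := by
  simp only [positonGamma, positonPhase_eq, waveGamma, wavePhaseLam,
    (wavePhase_hasDerivAt hk hb x t).deriv]

lemma negatonGamma_eq (hk : 0 < k) (hb : DifferentiableAt ℝ b k) (C : ℝ → ℝ) (x t : ℝ) :
    negatonGamma η b C k x t = waveGamma (-1) η b C k x t := by
  simp only [negatonGamma, negatonPhase_eq, waveGamma, wavePhaseLam,
    (wavePhase_hasDerivAt hk hb x t).deriv]
  ring

lemma positonDenom_eq (hk : 0 < k) (hb : DifferentiableAt ℝ b k) (C : ℝ → ℝ) (x t : ℝ) :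
    4 * k ^ 2 * positonGamma η b C k x t - Real.sin (2 * positonPhase η b k x t)
      = 2 * waveDenom 1 η b C Real.sin Real.cos k x t := by
  rw [positonGamma_eq hk hb, positonPhase_eq, waveDenom, Real.sin_two_mul]
  ring

lemma negatonDenom_eq (hk : 0 < k) (hb : DifferentiableAt ℝ b k) (C : ℝ → ℝ) (x t : ℝ) :
    2 * k ^ 2 * negatonGamma η b C k x t
        + Real.sinh (negatonPhase η b k x t) * Real.cosh (negatonPhase η b k x t)
      = waveDenom (-1) η b C Real.sinh Real.cosh k x t := by
  rw [negatonGamma_eq hk hb, negatonPhase_eq, waveDenom]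
  ring

end KdVES

end

theorem proposition2 {𝕜 : Type*} [RCLike 𝕜] :
    -- the second type of Darboux transformation
    (∀ (n : ℕ) (Ω : Set (ℝ × ℝ)) (lam : Fin n → 𝕜) (u : ℝ → ℝ → 𝕜)
      (φ : Fin n → ℝ → ℝ → 𝕜) (μ₀ : 𝕜) (f : ℝ → ℝ → 𝕜) (g : 𝕜 → ℝ → ℝ → 𝕜)
      (C s : ℝ → 𝕜) (T : ℝ → ℝ → 𝕜), T = KdVES.darbouxT C f g μ₀ →
      KdVES.DarbouxInput Ω lam u φ μ₀ f g C s →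
        KdVES.IsKdVES (KdVES.darbouxDomain Ω (g μ₀) T)
          (Fin.snoc (α := fun _ => 𝕜) lam μ₀) (KdVES.darbouxU u (g μ₀) T)
          (KdVES.darbouxPhi lam φ μ₀ f (g μ₀) T s) ∧
        ∀ (μ : 𝕜) (ψ : ℝ → ℝ → 𝕜), (∀ j, μ ≠ lam j) → μ ≠ μ₀ →
          KdVES.IsLax Ω lam u φ μ ψ →
          KdVES.IsLax (KdVES.darbouxDomain Ω (g μ₀) T)
            (Fin.snoc (α := fun _ => 𝕜) lam μ₀) (KdVES.darbouxU u (g μ₀) T)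
            (KdVES.darbouxPhi lam φ μ₀ f (g μ₀) T s) μ
            (KdVES.darbouxPsi (g μ₀) T ψ)) ∧
    -- it yields the positon solution
    (∀ (k : ℝ) (η b C : ℝ → ℝ) (f : ℝ → ℝ → ℝ) (g : ℝ → ℝ → ℝ → ℝ) (T : ℝ → ℝ → ℝ)
      (Ω : Set (ℝ × ℝ)), 0 < k → Differentiable ℝ η → (∀ t, 0 ≤ deriv η t) →
      DifferentiableAt ℝ b k → Differentiable ℝ C → (∀ t, 0 ≤ deriv C t) →
      f = (fun x t => Real.cos (KdVES.positonPhase η b k x t)) →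
      g = (fun μ x t => Real.sin (KdVES.positonPhase η b (√μ) x t)) →
      T = KdVES.darbouxT C f g (k ^ 2) →
      Ω = {p | 4 * k ^ 2 * KdVES.positonGamma η b C k p.1 p.2
        - Real.sin (2 * KdVES.positonPhase η b k p.1 p.2) ≠ 0} →
        KdVES.DarbouxInput Set.univ ![0] (fun _ _ => 0) ![fun _ t => √(deriv η t)]
          (k ^ 2) f g C (fun t => √(deriv C t / k)) ∧
        KdVES.darbouxDomain Set.univ (g (k ^ 2)) T = Ω ∧
        (∀ p ∈ Ω, KdVES.darbouxU (fun _ _ => 0) (g (k ^ 2)) T p.1 p.2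
          = KdVES.positonU η b C k p.1 p.2) ∧
        (∀ p ∈ Ω, ∀ j, KdVES.darbouxPhi ![0] ![fun _ t => √(deriv η t)] (k ^ 2) f
            (g (k ^ 2)) T (fun t => √(deriv C t / k)) j p.1 p.2
          = KdVES.positonPhi η b C k j p.1 p.2) ∧
        KdVES.IsKdVES Ω ![0, k ^ 2] (KdVES.positonU η b C k) (KdVES.positonPhi η b C k)) ∧
    -- it yields the negaton solution
    (∀ (k : ℝ) (η b C : ℝ → ℝ) (f : ℝ → ℝ → ℝ) (g : ℝ → ℝ → ℝ → ℝ) (T : ℝ → ℝ → ℝ)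
      (Ω : Set (ℝ × ℝ)), 0 < k → Differentiable ℝ η → (∀ t, 0 ≤ deriv η t) →
      DifferentiableAt ℝ b k → Differentiable ℝ C → (∀ t, 0 ≤ deriv C t) →
      f = (fun x t => Real.cosh (KdVES.negatonPhase η b k x t)) →
      g = (fun μ x t => Real.sinh (KdVES.negatonPhase η b (√(-μ)) x t)) →
      T = KdVES.darbouxT C f g (-k ^ 2) →
      Ω = {p | 2 * k ^ 2 * KdVES.negatonGamma η b C k p.1 p.2
        + Real.sinh (KdVES.negatonPhase η b k p.1 p.2)
          * Real.cosh (KdVES.negatonPhase η b k p.1 p.2) ≠ 0} →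
        KdVES.DarbouxInput Set.univ ![0] (fun _ _ => 0) ![fun _ t => √(deriv η t)]
          (-k ^ 2) f g C (fun t => √(deriv C t / k)) ∧
        KdVES.darbouxDomain Set.univ (g (-k ^ 2)) T = Ω ∧
        (∀ p ∈ Ω, KdVES.darbouxU (fun _ _ => 0) (g (-k ^ 2)) T p.1 p.2
          = KdVES.negatonU η b C k p.1 p.2) ∧
        (∀ p ∈ Ω, ∀ j, KdVES.darbouxPhi ![0] ![fun _ t => √(deriv η t)] (-k ^ 2) f
            (g (-k ^ 2)) T (fun t => √(deriv C t / k)) j p.1 p.2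
          = KdVES.negatonPhi η b C k j p.1 p.2) ∧
        KdVES.IsKdVES Ω ![0, -k ^ 2] (KdVES.negatonU η b C k) (KdVES.negatonPhi η b C k)) := by
  refine ⟨?_, ?_, ?_⟩
  · rintro n Ω lam u φ μ₀ f g C s T rfl h
    exact ⟨h.darboux_isKdVES, fun μ ψ hμ hμ₀ hψ => h.darboux_isLax hψ hμ hμ₀⟩
  · intro k η b C f g T Ω hk hη hη' hb hC hC' hf hg hT hΩ
    have hmem : ∀ x t, (x, t) ∈ Ω ↔
        KdVES.waveDenom 1 η b C Real.sin Real.cos k x t ≠ 0 := fun x t => by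
      simp [hΩ, KdVES.positonDenom_eq hk hb]
    refine KdVES.isWavePair_trig.darboux_transform hk hη hη' hb hC hC' (one_mul _).symm
      (by simp only [hf, KdVES.positonPhase_eq]) ?_ hT hmem (fun x t hp => ?_)
      (fun x t hp => ?_) fun x t hp => ?_
    · simp only [hg, KdVES.positonPhase_eq]
      funext μ x t
      rw [KdVES.waveFamily, one_mul]
    all_goals have hD := (hmem x t).1 hp
    · rw [KdVES.positonU, KdVES.positonDenom_eq hk hb, KdVES.positonGamma_eq hk hb,
        KdVES.positonPhase_eq]
      field_simp
      ring
    · simp only [KdVES.positonPhi, Matrix.cons_val_zero]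
      rw [KdVES.positonDenom_eq hk hb, KdVES.positonGamma_eq hk hb, KdVES.positonPhase_eq,
        Real.sin_two_mul]
      field_simp
      ring
    · simp only [KdVES.positonPhi, Matrix.cons_val_one, Matrix.cons_val_fin_one]
      rw [KdVES.positonDenom_eq hk hb, KdVES.positonPhase_eq]
      field_simp
      ring
  · intro k η b C f g T Ω hk hη hη' hb hC hC' hf hg hT hΩ
    have hmem : ∀ x t, (x, t) ∈ Ω ↔
        KdVES.waveDenom (-1) η b C Real.sinh Real.cosh k x t ≠ 0 := fun x t => by
      simp [hΩ, KdVES.negatonDenom_eq hk hb]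
    refine KdVES.isWavePair_hyperbolic.darboux_transform hk hη hη' hb hC hC'
      (neg_one_mul _).symm (by simp only [hf, KdVES.negatonPhase_eq]) ?_ hT hmem
      (fun x t hp => ?_) (fun x t hp => ?_) fun x t hp => ?_
    · simp only [hg, KdVES.negatonPhase_eq]
      funext μ x t
      rw [KdVES.waveFamily, neg_one_mul]
    all_goals have hD := (hmem x t).1 hp
    · rw [KdVES.negatonU, KdVES.negatonDenom_eq hk hb, KdVES.negatonGamma_eq hk hb,
        KdVES.negatonPhase_eq]
      field_simp
      ring
    · simp only [KdVES.negatonPhi, Matrix.cons_val_zero]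
      rw [KdVES.negatonDenom_eq hk hb, KdVES.negatonGamma_eq hk hb, KdVES.negatonPhase_eq]
      field_simp
      ring
    · simp only [KdVES.negatonPhi, Matrix.cons_val_one, Matrix.cons_val_fin_one]
      rw [KdVES.negatonDenom_eq hk hb, KdVES.negatonPhase_eq]
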